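/- Let $K$ be a commutative ring, unadorned $\otimes$ the tensor product over $K$, $(-)^*=\mathrm{Hom}_K(-,K)$. Let $(\mathcal C,\boxtimes,\mathbb I,a,l,r)$ be an essentially small monoidal category that is right rigid: every object $X$ has an object $X^\star$ with morphisms $\mathrm{ev}_X:X\boxtimes X^\star\to\mathbb I$ and $\mathrm{db}_X:\mathbb I\to X^\star\boxtimes X$ such that, up to the unit constraints, $(\mathrm{ev}_X\boxtimes X)\,a^{-1}_{X,X^\star,X}\,(X\boxtimes \mathrm{db}_X)=\mathrm{id}_X$ and $(X^\star\boxtimes \mathrm{ev}_X)\,a_{X^\star,X,X^\star}\,(\mathrm{db}_X\boxtimes X^\star)=\mathrm{id}_{X^\star}$. Fix such a choice of duals. Let $F$ be a functor from $\mathcal C$ to finitely generated projective $K$-modules with a neutral quasi-monoidal structure: an isomorphism $\varphi_0:K\to F(\mathbb I)$ and a natural isomorphism $\varphi_{X,Y}:F(X)\otimes F(Y)\to F(X\boxtimes Y)$ with $F(l_X)\,\varphi_{\mathbb I,X}(\varphi_0\otimes F(X))$ and $F(r_X)\,\varphi_{X,\mathbb I}(F(X)\otimes\varphi_0)$ the canonical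 isomorphisms (no compatibility with $a$ is required). Let $H$ be the coend of $F\otimes F^*$, that is, the quotient of $\bigoplus_{X} F(X)\otimes F(X)^*$ by the submodule generated by all $x\otimes(\psi\circ F(f))-F(f)(x)\otimes\psi$ with $f:X\to Y$, $x\in F(X)$, $\psi\in F(Y)^*$. Let $\delta_X:F(X)\to H\otimes F(X)$, $\delta_X(x)=\sum_i[x\otimes e^i]\otimes e_i$, where $\sum_i e^i\otimes e_i\in F(X)^*\otimes F(X)$ corresponds to $\mathrm{id}_{F(X)}$. For linear $f:H^{\otimes n}\to V$ let $\vartheta^n_V(f)_{X_1,\dots,X_n}:F(X_1)\otimes\cdots\otimes F(X_n)\to V\otimes F(X_1)\otimes\cdots\otimes F(X_n)$ apply $\delta_{X_1}\otimes\cdots\otimes\delta_{X_n}$, move the $H$-factors to the left in order, and apply $f$; write $\vartheta=\vartheta^1$. A coquasi-bialgebra is a coalgebra $(H,\Delta,\varepsilon)$ with coalgebra maps $m:H\otimes H\to H$ and $u:K\to H$ (put $1_H=u(1)$) and a convolution invertible linear form $\omega:H^{\otimes 3}\to K$ such that $m(u\otimes H)=\mathrm{id}=m(H\otimes u)$, $\omega(h\otimes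 1_H\otimes k)=\varepsilon(h)\varepsilon(k)$ for all $h,k\in H$, $m(H\otimes m)*\omega=\omega*m(m\otimes H)$ and $\omega(H\otimes H\otimes m)*\omega(m\otimes H\otimes H)=(\varepsilon\otimes\omega)*\omega(H\otimes m\otimes H)*(\omega\otimes\varepsilon)$, where $*$ is the convolution product. A preantipode for it is a linear map $S:H\to H$ such that for all $h\in H$, in Sweedler notation, $$\sum S(h_1)_1h_2\otimes S(h_1)_2=1_H\otimes S(h),\quad \sum S(h_2)_1\otimes h_1S(h_2)_2=S(h)\otimes 1_H,\quad \sum\omega(h_1\otimes S(h_2)\otimes h_3)=\varepsilon(h).$$ Then the following hold. (1) $H$ is small, i.e. isomorphic to a $K$-module in the universe of $K$ and of the modules $F(X)$. There is exactly one coquasi-bialgebra structure on $H$ such that for all $X,Y,Z$ in $\mathcal C$, up to the associativity and unit isomorphisms of $\otimes$: $\vartheta(\Delta)_X=(H\otimes\delta_X)\delta_X$, $\vartheta(\varepsilon)_X=\mathrm{id}_{F(X)}$, $(H\otimes\varphi_{X,Y})\,\vartheta^2(m)_{X,Y}=\delta_{X\boxtimes Y}\,\varphi_{X,Y}$, $(H\otimes\varphi_0)(u\otimes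 K)=\delta_{\mathbb I}\,\varphi_0$, and $\varphi_{X\boxtimes Y,Z}(\varphi_{X,Y}\otimes F(Z))\,\vartheta^3(\omega)_{X,Y,Z}=F(a^{-1}_{X,Y,Z})\,\varphi_{X,Y\boxtimes Z}(F(X)\otimes\varphi_{Y,Z})$. This is the coendomorphism coquasi-bialgebra of $(\mathcal C,F)$. (2) Put $\mathrm{ev}_{F(X)}=\varphi_0^{-1}F(\mathrm{ev}_X)\varphi_{X,X^\star}$ and $\mathrm{db}_{F(X)}=\varphi_{X^\star,X}^{-1}F(\mathrm{db}_X)\varphi_0$, and for $\xi:F\to V\otimes F$ let $$\nabla_V(\xi)_X=(V\otimes \mathrm{ev}_{F(X)}\otimes F(X))\,(\tau_{F(X),V}\otimes F(X^\star)\otimes F(X))\,(F(X)\otimes\xi_{X^\star}\otimes F(X))\,(F(X)\otimes \mathrm{db}_{F(X)}),$$ where $\tau$ is the flip. There is exactly one linear map $S:H\to H$ such that $\vartheta_H(S)_X=\nabla_H(\delta)_X$ for all $X$ in $\mathcal C$, and this $S$ is a preantipode for the coendomorphism coquasi-bialgebra $H$. In particular, $H$ has a preantipode. -/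

import Mathlib

open CategoryTheory MonoidalCategory TensorProduct

universe v u w

noncomputable section

/-! ### Quasi-monoidal functors -/

/-- A quasi-monoidal structure on a functor `F` between monoidal categories: an isomorphism
`φ₀ : 𝟙 ≅ F 𝟙` and a natural isomorphism `φ X Y : F X ⊗ F Y ≅ F (X ⊗ Y)`, with no compatibility
with the associativity constraints. -/
structure QuasiMonoidal {C : Type*} [Category C] [MonoidalCategory C] {D : Type*} [Category D]
    [MonoidalCategory D] (F : C ⥤ D) where
  unitIso : 𝟙_ D ≅ F.obj (𝟙_ C)
  tensorIso : ∀ X Y : C, F.obj X ⊗ F.obj Y ≅ F.obj (X ⊗ Y)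
  naturality : ∀ {X X' Y Y' : C} (f : X ⟶ X') (g : Y ⟶ Y'),
    (F.map f ⊗ₘ F.map g) ≫ (tensorIso X' Y').hom = (tensorIso X Y).hom ≫ F.map (f ⊗ₘ g)

/-- A quasi-monoidal functor is neutral if it is compatible with the left and right unit
constraints. -/
structure QuasiMonoidal.IsNeutral {C : Type*} [Category C] [MonoidalCategory C] {D : Type*}
    [Category D] [MonoidalCategory D] {F : C ⥤ D} (φ : QuasiMonoidal F) : Prop where
  left_unit : ∀ X : C, (φ.unitIso.hom ▷ F.obj X) ≫ (φ.tensorIso (𝟙_ C) X).hom ≫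
    F.map (λ_ X).hom = (λ_ (F.obj X)).hom
  right_unit : ∀ X : C, (F.obj X ◁ φ.unitIso.hom) ≫ (φ.tensorIso X (𝟙_ C)).hom ≫
    F.map (ρ_ X).hom = (ρ_ (F.obj X)).hom

/-! ### Coquasi-bialgebras and preantipodes -/

section Convolution

variable {K : Type*} [CommRing K] {A : Type*} [AddCommGroup A] [Module K A] [Coalgebra K A]
  {M : Type*} [AddCommGroup M] [Module K M]

/-- The convolution product `x ↦ ∑ α (x₁) • f (x₂)` of a linear form with a linear map. -/
def convLeft (α : A →ₗ[K] K) (f : A →ₗ[K] M) : A →ₗ[K] M :=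
  (TensorProduct.lid K M).toLinearMap ∘ₗ TensorProduct.map α f ∘ₗ Coalgebra.comul

/-- The convolution product `x ↦ ∑ α (x₂) • f (x₁)` of a linear map with a linear form. -/
def convRight (f : A →ₗ[K] M) (α : A →ₗ[K] K) : A →ₗ[K] M :=
  (TensorProduct.rid K M).toLinearMap ∘ₗ TensorProduct.map f α ∘ₗ Coalgebra.comul

end Convolution

/-- A coquasi-bialgebra `(H, m, 1, Δ, ε, ω)` over a commutative ring `K` (with trivial unit
constraints): a coalgebra with a unit element and a multiplication that are coalgebra maps,
together with a convolution invertible reassociator `ω ∈ (H ⊗ H ⊗ H)^*`. Iterated tensor products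
are bracketed to the right and carry the tensor product coalgebra structure. -/
@[ext]
class CoquasiBialgebra (K : Type*) (H : Type*) [CommRing K] [AddCommGroup H] [Module K H] extends
    Coalgebra K H where
  /-- the multiplication `m` -/
  mul : H ⊗[K] H →ₗ[K] H
  /-- the unit `1_H` -/
  one : H
  /-- the reassociator `ω` -/
  reassoc : H ⊗[K] (H ⊗[K] H) →ₗ[K] K
  comul_mul : comul ∘ₗ mul = TensorProduct.map mul mul ∘ₗ
    (Coalgebra.comul : H ⊗[K] H →ₗ[K] (H ⊗[K] H) ⊗[K] (H ⊗[K] H))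
  counit_mul : counit ∘ₗ mul = (Coalgebra.counit : H ⊗[K] H →ₗ[K] K)
  comul_one : comul one = one ⊗ₜ[K] one
  counit_one : counit one = 1
  one_mul : ∀ h : H, mul (one ⊗ₜ[K] h) = h
  mul_one : ∀ h : H, mul (h ⊗ₜ[K] one) = h
  /-- `ω` is invertible for the convolution product -/
  reassoc_invertible : ∃ ω' : H ⊗[K] (H ⊗[K] H) →ₗ[K] K,
    convLeft reassoc ω' = Coalgebra.counit ∧ convLeft ω' reassoc = Coalgebra.counit
  /-- `ω (H ⊗ u ⊗ H) = ε ⊗ ε` -/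
  reassoc_one : ∀ h k : H, reassoc (h ⊗ₜ[K] (one ⊗ₜ[K] k)) = counit h * counit k
  /-- `m (H ⊗ m) * ω = ω * m (m ⊗ H)` -/
  quasi_assoc :
    convRight (mul ∘ₗ mul.lTensor H) reassoc =
      convLeft reassoc (mul ∘ₗ mul.rTensor H ∘ₗ (TensorProduct.assoc K H H H).symm.toLinearMap)
  /-- `ω (H ⊗ H ⊗ m) * ω (m ⊗ H ⊗ H) = (ε ⊗ ω) * ω (H ⊗ m ⊗ H) * (ω ⊗ ε)` on `H ⊗ H ⊗ H ⊗ H` -/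
  cocycle :
    convLeft (reassoc ∘ₗ (mul.lTensor H).lTensor H)
      (reassoc ∘ₗ mul.rTensor (H ⊗[K] H) ∘ₗ
        (TensorProduct.assoc K H H (H ⊗[K] H)).symm.toLinearMap) =
    convLeft ((TensorProduct.lid K K).toLinearMap ∘ₗ TensorProduct.map counit reassoc)
      (convLeft
        (reassoc ∘ₗ
          (mul.rTensor H ∘ₗ (TensorProduct.assoc K H H H).symm.toLinearMap).lTensor H)
        ((TensorProduct.lid K K).toLinearMap ∘ₗ TensorProduct.map reassoc counit ∘ₗ
          (TensorProduct.assoc K H (H ⊗[K] H) H).symm.toLinearMap ∘ₗ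
            (TensorProduct.assoc K H H H).symm.toLinearMap.lTensor H))

/-- A preantipode for a coquasi-bialgebra `H` is a `K`-linear endomorphism `S` of `H` with
`∑ S(h₁)₁ h₂ ⊗ S(h₁)₂ = 1 ⊗ S(h)`, `∑ S(h₂)₁ ⊗ h₁ S(h₂)₂ = S(h) ⊗ 1` and
`∑ ω(h₁ ⊗ S(h₂) ⊗ h₃) = ε(h)` for all `h`. -/
structure IsPreantipode (K : Type*) {H : Type*} [CommRing K] [AddCommGroup H] [Module K H]
    [CoquasiBialgebra K H] (S : H →ₗ[K] H) : Prop where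
  left : ∀ h : H,
    (CoquasiBialgebra.mul (K := K) (H := H)).rTensor H
      (TensorProduct.rightComm K H H H
        ((Coalgebra.comul ∘ₗ S).rTensor H (Coalgebra.comul (R := K) h))) =
      (CoquasiBialgebra.one K : H) ⊗ₜ[K] S h
  right : ∀ h : H,
    (CoquasiBialgebra.mul (K := K) (H := H)).lTensor H
      (TensorProduct.leftComm K H H H
        ((Coalgebra.comul ∘ₗ S).lTensor H (Coalgebra.comul (R := K) h))) =
      S h ⊗ₜ[K] (CoquasiBialgebra.one K : H)
  reassoc : ∀ h : H,
    CoquasiBialgebra.reassoc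
      ((S.rTensor H ∘ₗ Coalgebra.comul).lTensor H (Coalgebra.comul (R := K) h)) =
      Coalgebra.counit (R := K) h

/-! ### The coend of `F ⊗ F^*` -/

section Coend

variable {K : Type w} [CommRing K] {C : Type u} [Category.{v} C] (F : C ⥤ ModuleCat.{w} K)

open Classical in
/-- The element `x ⊗ ψ` of the summand `F X ⊗ (F X)^*` of `⨁ X, F X ⊗ (F X)^*`. -/
def coendGen (X : C) (x : F.obj X) (ψ : Module.Dual K (F.obj X)) :
    DirectSum C (fun X : C => F.obj X ⊗[K] Module.Dual K (F.obj X)) :=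
  DirectSum.lof K C (fun X : C => F.obj X ⊗[K] Module.Dual K (F.obj X)) X (x ⊗ₜ[K] ψ)

/-- The dinaturality relations `x ⊗ (ψ ∘ F f) = F f x ⊗ ψ`, for `f : X ⟶ Y`, `x ∈ F X` and
`ψ ∈ (F Y)^*`. -/
def coendRel : Submodule K (DirectSum C (fun X : C => F.obj X ⊗[K] Module.Dual K (F.obj X))) :=
  Submodule.span K { t | ∃ (X Y : C) (f : X ⟶ Y) (x : F.obj X) (ψ : Module.Dual K (F.obj Y)),
    t = coendGen F X x (ψ ∘ₗ (F.map f).hom) - coendGen F Y ((F.map f).hom x) ψ }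

/-- The coend of the functor `F ⊗ F^*` on `C × Cᵒᵖ`, as a `K`-module. -/
abbrev Coend : Type (max u w) :=
  DirectSum C (fun X : C => F.obj X ⊗[K] Module.Dual K (F.obj X)) ⧸ coendRel F

open Classical in
/-- The canonical map `F X ⊗ (F X)^* → H` into the coend. -/
def coendι (X : C) : F.obj X ⊗[K] Module.Dual K (F.obj X) →ₗ[K] Coend F :=
  (coendRel F).mkQ ∘ₗ
    DirectSum.lof K C (fun X : C => F.obj X ⊗[K] Module.Dual K (F.obj X)) X

variable [∀ X, Module.Finite K (F.obj X)] [∀ X, Module.Projective K (F.obj X)]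

/-- The canonical coaction `δ_X : F X → H ⊗ F X`, `x ↦ ∑ᵢ [x ⊗ eⁱ] ⊗ eᵢ`, where
`∑ᵢ eⁱ ⊗ eᵢ ∈ (F X)^* ⊗ F X` is the dual basis element, i.e. the element that corresponds to the
identity of `F X`. -/
def coendCoact (X : C) : F.obj X →ₗ[K] Coend F ⊗[K] F.obj X :=
  (coendι F X).rTensor (F.obj X) ∘ₗ
    (TensorProduct.assoc K (F.obj X) (Module.Dual K (F.obj X)) (F.obj X)).symm.toLinearMap ∘ₗ
      (TensorProduct.mk K (F.obj X) (Module.Dual K (F.obj X) ⊗[K] F.obj X)).flip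
        ((dualTensorHomEquiv K (F.obj X) (F.obj X)).symm LinearMap.id)

/-- The tensor product `x ⊗ y ↦ ∑ (x₋₁ ⊗ y₋₁) ⊗ (x₀ ⊗ y₀)` of two maps `x ↦ ∑ x₋₁ ⊗ x₀` and
`y ↦ ∑ y₋₁ ⊗ y₀`. -/
def coactTensor {A B M N : Type*} [AddCommGroup A] [Module K A] [AddCommGroup B] [Module K B]
    [AddCommGroup M] [Module K M] [AddCommGroup N] [Module K N]
    (ρ : M →ₗ[K] A ⊗[K] M) (σ : N →ₗ[K] B ⊗[K] N) :
    M ⊗[K] N →ₗ[K] (A ⊗[K] B) ⊗[K] (M ⊗[K] N) :=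
  (TensorProduct.tensorTensorTensorComm K A M B N).toLinearMap ∘ₗ TensorProduct.map ρ σ

/-- `ϑ_V(f)_X = (f ⊗ F X) δ_X`, for a linear map `f : H → V`. -/
def theta {V : Type*} [AddCommGroup V] [Module K V] (f : Coend F →ₗ[K] V) (X : C) :
    F.obj X →ₗ[K] V ⊗[K] F.obj X :=
  f.rTensor (F.obj X) ∘ₗ coendCoact F X

/-- `ϑ²_V(f)_{X,Y}`, for a linear map `f : H ⊗ H → V`. -/
def theta₂ {V : Type*} [AddCommGroup V] [Module K V] (f : Coend F ⊗[K] Coend F →ₗ[K] V)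
    (X Y : C) : F.obj X ⊗[K] F.obj Y →ₗ[K] V ⊗[K] (F.obj X ⊗[K] F.obj Y) :=
  f.rTensor (F.obj X ⊗[K] F.obj Y) ∘ₗ coactTensor (coendCoact F X) (coendCoact F Y)

/-- `ϑ³_V(f)_{X,Y,Z}`, for a linear map `f : H ⊗ H ⊗ H → V`. -/
def theta₃ {V : Type*} [AddCommGroup V] [Module K V]
    (f : Coend F ⊗[K] (Coend F ⊗[K] Coend F) →ₗ[K] V) (X Y Z : C) :
    F.obj X ⊗[K] (F.obj Y ⊗[K] F.obj Z) →ₗ[K] V ⊗[K] (F.obj X ⊗[K] (F.obj Y ⊗[K] F.obj Z)) :=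
  f.rTensor (F.obj X ⊗[K] (F.obj Y ⊗[K] F.obj Z)) ∘ₗ
    coactTensor (coendCoact F X) (coactTensor (coendCoact F Y) (coendCoact F Z))

end Coend

/-! ### The coendomorphism coquasi-bialgebra and the transformation `∇` -/

section Reconstruction

variable {K : Type w} [CommRing K] {C : Type u} [Category.{v} C] [MonoidalCategory C]
  {F : C ⥤ ModuleCat.{w} K}

/-- `φ₀ : K → F 𝟙` as a linear equivalence. -/
def QuasiMonoidal.unitEquiv (φ : QuasiMonoidal F) : K ≃ₗ[K] F.obj (𝟙_ C) :=
  φ.unitIso.toLinearEquiv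

/-- `φ_{X,Y} : F X ⊗ F Y → F (X ⊗ Y)` as a linear equivalence. -/
def QuasiMonoidal.tensorEquiv (φ : QuasiMonoidal F) (X Y : C) :
    F.obj X ⊗[K] F.obj Y ≃ₗ[K] F.obj (X ⊗ Y) :=
  (φ.tensorIso X Y).toLinearEquiv

/-- The defining relations of the coendomorphism coquasi-bialgebra of `(C, F)`, for a
coquasi-bialgebra structure on the coend of `F ⊗ F^*`. -/
structure IsCoendomorphism [∀ X, Module.Finite K (F.obj X)] [∀ X, Module.Projective K (F.obj X)]
    (φ : QuasiMonoidal F) (B : CoquasiBialgebra K (Coend F)) : Prop where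
  /-- `ϑ(Δ) = (H ⊗ δ) δ` -/
  comul : ∀ X : C, theta F B.comul X =
    (TensorProduct.assoc K (Coend F) (Coend F) (F.obj X)).symm.toLinearMap ∘ₗ
      (coendCoact F X).lTensor (Coend F) ∘ₗ coendCoact F X
  /-- `ϑ(ε) = id` -/
  counit : ∀ X : C,
    (TensorProduct.lid K (F.obj X)).toLinearMap ∘ₗ theta F B.counit X = LinearMap.id
  /-- `(H ⊗ φ_{X,Y}) ϑ²(m)_{X,Y} = δ_{X ⊗ Y} φ_{X,Y}` -/
  mul : ∀ X Y : C, (φ.tensorEquiv X Y).toLinearMap.lTensor (Coend F) ∘ₗ theta₂ F B.mul X Y =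
    coendCoact F (X ⊗ Y) ∘ₗ (φ.tensorEquiv X Y).toLinearMap
  /-- `(H ⊗ φ₀) (u ⊗ K) = δ_𝟙 φ₀` -/
  one : ∀ k : K, B.one ⊗ₜ[K] φ.unitEquiv k = coendCoact F (𝟙_ C) (φ.unitEquiv k)
  /-- `φ_{X ⊗ Y,Z} (φ_{X,Y} ⊗ F Z) ϑ³(ω)_{X,Y,Z} = F (a⁻¹) φ_{X,Y ⊗ Z} (F X ⊗ φ_{Y,Z})` -/
  reassoc : ∀ X Y Z : C,
    (φ.tensorEquiv (X ⊗ Y) Z).toLinearMap ∘ₗ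
      (φ.tensorEquiv X Y).toLinearMap.rTensor (F.obj Z) ∘ₗ
      (TensorProduct.assoc K (F.obj X) (F.obj Y) (F.obj Z)).symm.toLinearMap ∘ₗ
      (TensorProduct.lid K (F.obj X ⊗[K] (F.obj Y ⊗[K] F.obj Z))).toLinearMap ∘ₗ
      theta₃ F B.reassoc X Y Z =
    (F.map (α_ X Y Z).inv).hom ∘ₗ (φ.tensorEquiv X (Y ⊗ Z)).toLinearMap ∘ₗ
      (φ.tensorEquiv Y Z).toLinearMap.lTensor (F.obj X)

variable [LeftRigidCategory C]

/- A dual `(X^⋆, ev : X ⊗ X^⋆ ⟶ 𝟙, db : 𝟙 ⟶ X^⋆ ⊗ X)` of `X`, called a right dual in part of the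
literature, is `ᘁX` in Mathlib's terminology, with `ev = ε_ (ᘁX) X` and `db = η_ (ᘁX) X`. -/

/-- The evaluation `φ₀⁻¹ F(ev_X) φ_{X,X^⋆} : F X ⊗ F X^⋆ → K`. -/
def QuasiMonoidal.evalMap (φ : QuasiMonoidal F) (X : C) :
    F.obj X ⊗[K] F.obj (ᘁX : C) →ₗ[K] K :=
  φ.unitEquiv.symm.toLinearMap ∘ₗ (F.map (ε_ (ᘁX : C) X)).hom ∘ₗ
    (φ.tensorEquiv X (ᘁX : C)).toLinearMap

/-- The dual basis map `φ_{X^⋆,X}⁻¹ F(db_X) φ₀ : K → F X^⋆ ⊗ F X`. -/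
def QuasiMonoidal.dualBasisMap (φ : QuasiMonoidal F) (X : C) :
    K →ₗ[K] F.obj (ᘁX : C) ⊗[K] F.obj X :=
  (φ.tensorEquiv (ᘁX : C) X).symm.toLinearMap ∘ₗ (F.map (η_ (ᘁX : C) X)).hom ∘ₗ
    φ.unitEquiv.toLinearMap

/-- The component at `X` of `∇_V(ξ)`, for a family `ξ : F → V ⊗ F`: the composite
`F X → F X ⊗ F X^⋆ ⊗ F X → F X ⊗ V ⊗ F X^⋆ ⊗ F X → V ⊗ F X ⊗ F X^⋆ ⊗ F X → V ⊗ F X` of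
`F X ⊗ db`, `F X ⊗ ξ_{X^⋆} ⊗ F X`, the flip of `F X` and `V`, and `V ⊗ ev ⊗ F X`. -/
def QuasiMonoidal.nabla (φ : QuasiMonoidal F) {V : Type*} [AddCommGroup V] [Module K V]
    (ξ : ∀ X : C, F.obj X →ₗ[K] V ⊗[K] F.obj X) (X : C) : F.obj X →ₗ[K] V ⊗[K] F.obj X :=
  ((TensorProduct.lid K (F.obj X)).toLinearMap ∘ₗ (φ.evalMap X).rTensor (F.obj X) ∘ₗ
      (TensorProduct.assoc K (F.obj X) (F.obj (ᘁX : C)) (F.obj X)).symm.toLinearMap).lTensor V ∘ₗ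
    (TensorProduct.leftComm K (F.obj X) V (F.obj (ᘁX : C) ⊗[K] F.obj X)).toLinearMap ∘ₗ
    ((TensorProduct.assoc K V (F.obj (ᘁX : C)) (F.obj X)).toLinearMap ∘ₗ
      (ξ (ᘁX : C)).rTensor (F.obj X) ∘ₗ φ.dualBasisMap X).lTensor (F.obj X) ∘ₗ
    (TensorProduct.rid K (F.obj X)).symm.toLinearMap

end Reconstruction

end

/-! For a finitely generated projective module `M`, a map `M → A ⊗ M` is determined by its matrix
coefficients, the contractions with linear forms on `M`. The generators `[x ⊗ ψ]` of the coend `H`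
are exactly the matrix coefficients of the coactions `δ`, and the defining relations of `H` say that
each `F f` is colinear. Hence linear maps `H → V` correspond to natural families `F → V ⊗ F`, and
likewise for `H ⊗ H` and `H ⊗ H ⊗ H`: existence is `exists_theta_eq` and its variants, uniqueness is
`Generates.hom_ext` together with `Generates.tensor`.

Every structure map of `H` is obtained from such a family, and every axiom is checked after acting
on the modules `F X`. The multiplication is the map that makes `φ` colinear. A linear form on `H ⊗ H
⊗ H` acts as a natural endomorphism of `F X ⊗ F Y ⊗ F Z` (`hat`), and convolution becomes
composition in the opposite order (`IsCoaction.hat_convLeft`). The form `ω` acts by the associator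
transported through `φ` (`reassocEquiv`), which is invertible, so `ω` is convolution invertible.
Quasi-associativity is the colinearity of `F (a⁻¹)`, the normalization of `ω` is the triangle axiom
together with neutrality, and the cocycle condition is the pentagon axiom.

The family `∇(δ)` is natural because evaluation and dual basis morphisms are dinatural, so it
defines `S`, which sends a coefficient of `F X` to a coefficient of `F X^⋆`. The three preantipode
identities come respectively from the colinearity of `db`, the colinearity of `ev`, and the zigzag
identity containing `a⁻¹`, which is the action of `ω`. -/

/-! ### Contractions, matrix coefficients and intertwiners -/

section Comodule

variable {K : Type*} [CommRing K]
  {A : Type*} [AddCommGroup A] [Module K A] {B : Type*} [AddCommGroup B] [Module K B]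
  {D : Type*} [AddCommGroup D] [Module K D]
  {V : Type*} [AddCommGroup V] [Module K V] {W : Type*} [AddCommGroup W] [Module K W]
  {M : Type*} [AddCommGroup M] [Module K M] {N : Type*} [AddCommGroup N] [Module K N]
  {P : Type*} [AddCommGroup P] [Module K P]

/-- A finite projective module has a finite dual basis. -/
theorem exists_dual_basis (K : Type*) [CommRing K] (M : Type*) [AddCommGroup M] [Module K M]
    [Module.Finite K M] [Module.Projective K M] :
    ∃ (n : ℕ) (e : Fin n → M) (e' : Fin n → Module.Dual K M), ∀ x, ∑ i, e' i x • e i = x := by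
  obtain ⟨n, f, g, -, -, h⟩ := Module.Finite.exists_comp_eq_id_of_projective K M
  refine ⟨n, fun i => f (Pi.single i 1), fun i => LinearMap.proj i ∘ₗ g, fun x => ?_⟩
  calc _ = f (∑ i, g x i • Pi.single i 1) := by simp
    _ = f (g x) := by congr 1; exact (pi_eq_sum_univ' (g x)).symm
    _ = x := LinearMap.congr_fun h x

/-- The contraction `a ⊗ m ↦ μ m • a`. -/
noncomputable def contract (μ : Module.Dual K M) : A ⊗[K] M →ₗ[K] A :=
  (TensorProduct.rid K A).toLinearMap ∘ₗ μ.lTensor A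

@[simp] theorem contract_tmul (μ : Module.Dual K M) (a : A) (m : M) :
    contract μ (a ⊗ₜ[K] m) = μ m • a := by simp [contract]

theorem contract_map (μ : Module.Dual K N) (f : A →ₗ[K] B) (g : M →ₗ[K] N) (t : A ⊗[K] M) :
    contract μ (TensorProduct.map f g t) = f (contract (μ ∘ₗ g) t) := by
  induction t with
  | zero => simp
  | add _ _ h₁ h₂ => simp only [map_add, h₁, h₂]
  | tmul => simp

theorem contract_rTensor (μ : Module.Dual K M) (f : A →ₗ[K] B) (t : A ⊗[K] M) :
    contract μ (f.rTensor M t) = f (contract μ t) :=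
  contract_map μ f LinearMap.id t

theorem contract_lTensor (μ : Module.Dual K N) (g : M →ₗ[K] N) (t : A ⊗[K] M) :
    contract μ (g.lTensor A t) = contract (μ ∘ₗ g) t :=
  contract_map μ LinearMap.id g t

theorem contract_eq_lid (μ : Module.Dual K M) (t : K ⊗[K] M) :
    contract μ t = μ (TensorProduct.lid K M t) := by
  induction t with
  | zero => simp
  | add _ _ h₁ h₂ => simp only [map_add, h₁, h₂]
  | tmul => simp [mul_comm]

theorem sum_contract_tmul {ι : Type*} [Fintype ι] {e : ι → M} {e' : ι → Module.Dual K M}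
    (he : ∀ x, ∑ i, e' i x • e i = x) (t : A ⊗[K] M) :
    ∑ i, contract (e' i) t ⊗ₜ[K] e i = t := by
  induction t with
  | zero => simp
  | add _ _ h₁ h₂ => simp only [map_add, TensorProduct.add_tmul, Finset.sum_add_distrib, h₁, h₂]
  | tmul a m => simp only [contract_tmul, TensorProduct.smul_tmul, ← TensorProduct.tmul_sum, he]

/-- A dual basis of `M` rebuilds `t` from its contractions. This is where finite generation and
projectivity enter. -/
theorem contract_ext [Module.Finite K M] [Module.Projective K M] {t t' : A ⊗[K] M}
    (h : ∀ μ : Module.Dual K M, contract μ t = contract μ t') : t = t' := by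
  obtain ⟨n, e, e', he⟩ := exists_dual_basis K M
  rw [← sum_contract_tmul he t, ← sum_contract_tmul he t']
  simp [h]

/-- The tensor product of two linear forms. -/
abbrev dualTmul (μ : Module.Dual K M) (ν : Module.Dual K N) : Module.Dual K (M ⊗[K] N) :=
  TensorProduct.dualDistrib K M N (μ ⊗ₜ[K] ν)

theorem dualTmul_comp_map (μ : Module.Dual K M) (ν : Module.Dual K N) (f : A →ₗ[K] M)
    (g : B →ₗ[K] N) : dualTmul μ ν ∘ₗ TensorProduct.map f g = dualTmul (μ ∘ₗ f) (ν ∘ₗ g) := by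
  ext; simp

theorem contract_dualTmul (μ : Module.Dual K M) (ν : Module.Dual K N) (t : A ⊗[K] (M ⊗[K] N)) :
    contract (dualTmul μ ν) t =
      contract μ (contract ν ((TensorProduct.assoc K A M N).symm t)) := by
  induction t with
  | zero => simp
  | add _ _ h₁ h₂ => simp only [map_add, h₁, h₂]
  | tmul a t =>
    induction t with
    | zero => simp
    | add _ _ h₁ h₂ => simp only [TensorProduct.tmul_add, map_add, h₁, h₂]
    | tmul m n => simp [smul_smul, mul_comm]

/-- Pure forms suffice, since contraction with `μ ⊗ ν` is contraction in one factor after the other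
and each of them separates elements. -/
theorem contract_dualTmul_ext [Module.Finite K M] [Module.Projective K M] [Module.Finite K N]
    [Module.Projective K N] {t t' : A ⊗[K] (M ⊗[K] N)}
    (h : ∀ (μ : Module.Dual K M) (ν : Module.Dual K N),
      contract (dualTmul μ ν) t = contract (dualTmul μ ν) t') : t = t' := by
  apply (TensorProduct.assoc K A M N).symm.injective
  refine contract_ext fun ν => contract_ext fun μ => ?_
  simpa only [contract_dualTmul] using h μ ν

theorem contract_dualTmul₃_ext [Module.Finite K M] [Module.Projective K M] [Module.Finite K N]
    [Module.Projective K N] [Module.Finite K P] [Module.Projective K P]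
    {t t' : A ⊗[K] (M ⊗[K] (N ⊗[K] P))}
    (h : ∀ (μ : Module.Dual K M) (ν : Module.Dual K N) (π : Module.Dual K P),
      contract (dualTmul μ (dualTmul ν π)) t = contract (dualTmul μ (dualTmul ν π)) t') :
    t = t' := by
  apply (TensorProduct.assoc K A M (N ⊗[K] P)).symm.injective
  refine contract_dualTmul_ext fun ν π => contract_ext fun μ => ?_
  simpa only [contract_dualTmul _ (dualTmul ν π)] using h μ ν π

/-- The matrix coefficient `m ⊗ μ ↦ μ m₀ • m₋₁` of a map `m ↦ m₋₁ ⊗ m₀`. -/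
noncomputable def coeff (ρ : M →ₗ[K] A ⊗[K] M) : M ⊗[K] Module.Dual K M →ₗ[K] A :=
  TensorProduct.lift <| LinearMap.flip <|
    (LinearMap.lcomp K A ρ) ∘ₗ (TensorProduct.rid K A).toLinearMap.compRight K ∘ₗ
      LinearMap.lTensorHom A

@[simp] theorem coeff_tmul (ρ : M →ₗ[K] A ⊗[K] M) (m : M) (μ : Module.Dual K M) :
    coeff ρ (m ⊗ₜ[K] μ) = contract μ (ρ m) := rfl

/-- The action `m ↦ α m₋₁ • m₀` of a linear form. -/
noncomputable def hat (ρ : M →ₗ[K] A ⊗[K] M) (α : A →ₗ[K] K) : M →ₗ[K] M :=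
  (TensorProduct.lid K M).toLinearMap ∘ₗ α.rTensor M ∘ₗ ρ

/-- The bridge between the two views of a linear form: its values on matrix coefficients are the
matrix entries of its action. -/
theorem dual_hat (ρ : M →ₗ[K] A ⊗[K] M) (α : A →ₗ[K] K) (m : M) (μ : Module.Dual K M) :
    μ (hat ρ α m) = α (contract μ (ρ m)) := by
  rw [← contract_rTensor, contract_eq_lid]; rfl

/-- A pair `(f, e)` intertwines `ρ : M → A ⊗ M` and `σ : N → B ⊗ N`. -/
def Intertwines (f : A →ₗ[K] B) (e : M →ₗ[K] N) (ρ : M →ₗ[K] A ⊗[K] M) (σ : N →ₗ[K] B ⊗[K] N) :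
    Prop :=
  TensorProduct.map f e ∘ₗ ρ = σ ∘ₗ e

theorem Intertwines.apply {f : A →ₗ[K] B} {e : M →ₗ[K] N} {ρ : M →ₗ[K] A ⊗[K] M}
    {σ : N →ₗ[K] B ⊗[K] N} (h : Intertwines f e ρ σ) (m : M) :
    TensorProduct.map f e (ρ m) = σ (e m) := LinearMap.congr_fun h m

theorem Intertwines.comp {f : A →ₗ[K] B} {e : M →ₗ[K] N} {ρ : M →ₗ[K] A ⊗[K] M}
    {σ : N →ₗ[K] B ⊗[K] N} {g : B →ₗ[K] D} {e' : N →ₗ[K] P} {τ : P →ₗ[K] D ⊗[K] P}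
    (h' : Intertwines g e' σ τ) (h : Intertwines f e ρ σ) :
    Intertwines (g ∘ₗ f) (e' ∘ₗ e) ρ τ := by
  ext m
  rw [TensorProduct.map_comp]
  simp [h.apply, h'.apply]

theorem Intertwines.refl (ρ : M →ₗ[K] A ⊗[K] M) :
    Intertwines LinearMap.id LinearMap.id ρ ρ := by
  simp [Intertwines]

theorem coactTensor_tmul (ρ : M →ₗ[K] A ⊗[K] M) (σ : N →ₗ[K] B ⊗[K] N) (m : M) (n : N) :
    coactTensor ρ σ (m ⊗ₜ[K] n) =
      TensorProduct.tensorTensorTensorComm K A M B N (ρ m ⊗ₜ[K] σ n) := rfl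

theorem map_tensorTensorTensorComm {A' B' M' N' : Type*} [AddCommGroup A'] [Module K A']
    [AddCommGroup B'] [Module K B'] [AddCommGroup M'] [Module K M'] [AddCommGroup N'] [Module K N']
    (f : A →ₗ[K] A') (g : B →ₗ[K] B') (e : M →ₗ[K] M') (e' : N →ₗ[K] N')
    (s : A ⊗[K] M) (t : B ⊗[K] N) :
    TensorProduct.map (TensorProduct.map f g) (TensorProduct.map e e')
        (TensorProduct.tensorTensorTensorComm K A M B N (s ⊗ₜ[K] t)) =
      TensorProduct.tensorTensorTensorComm K A' M' B' N'
        (TensorProduct.map f e s ⊗ₜ[K] TensorProduct.map g e' t) := by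
  induction s with
  | zero => simp
  | add _ _ h₁ h₂ => simp only [map_add, TensorProduct.add_tmul, h₁, h₂]
  | tmul a m =>
    induction t with
    | zero => simp
    | add _ _ h₁ h₂ => simp only [map_add, TensorProduct.tmul_add, h₁, h₂]
    | tmul b n => simp

theorem Intertwines.tensor {A' B' M' N' : Type*} [AddCommGroup A'] [Module K A']
    [AddCommGroup B'] [Module K B'] [AddCommGroup M'] [Module K M'] [AddCommGroup N'] [Module K N']
    {f : A →ₗ[K] A'} {e : M →ₗ[K] M'} {ρ : M →ₗ[K] A ⊗[K] M} {ρ' : M' →ₗ[K] A' ⊗[K] M'}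
    {g : B →ₗ[K] B'} {e' : N →ₗ[K] N'} {σ : N →ₗ[K] B ⊗[K] N} {σ' : N' →ₗ[K] B' ⊗[K] N'}
    (h : Intertwines f e ρ ρ') (h' : Intertwines g e' σ σ') :
    Intertwines (TensorProduct.map f g) (TensorProduct.map e e') (coactTensor ρ σ)
      (coactTensor ρ' σ') := by
  refine TensorProduct.ext' fun m n => ?_
  simp [coactTensor_tmul, map_tensorTensorTensorComm, h.apply, h'.apply]

theorem intertwines_assoc_symm (ρ : M →ₗ[K] A ⊗[K] M) (σ : N →ₗ[K] B ⊗[K] N)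
    (τ : P →ₗ[K] D ⊗[K] P) :
    Intertwines (TensorProduct.assoc K A B D).symm.toLinearMap
      (TensorProduct.assoc K M N P).symm.toLinearMap
      (coactTensor ρ (coactTensor σ τ)) (coactTensor (coactTensor ρ σ) τ) := by
  unfold Intertwines
  apply TensorProduct.ext'
  intro m t
  induction t with
  | zero => simp
  | add _ _ h₁ h₂ => simp only [TensorProduct.tmul_add, map_add, h₁, h₂]
  | tmul n p =>
    simp only [LinearMap.comp_apply, coactTensor_tmul, LinearEquiv.coe_coe,
      TensorProduct.assoc_symm_tmul]
    generalize ρ m = r, σ n = s, τ p = t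
    induction r with
    | zero => simp
    | add _ _ h₁ h₂ => simp only [map_add, TensorProduct.add_tmul, h₁, h₂]
    | tmul a m =>
      induction s with
      | zero => simp
      | add _ _ h₁ h₂ => simp only [map_add, TensorProduct.add_tmul, TensorProduct.tmul_add, h₁, h₂]
      | tmul b n =>
        induction t with
        | zero => simp
        | add _ _ h₁ h₂ => simp only [map_add, TensorProduct.tmul_add, h₁, h₂]
        | tmul b n => simp

theorem contract_coactTensor (ρ : M →ₗ[K] A ⊗[K] M) (σ : N →ₗ[K] B ⊗[K] N) (m : M) (n : N)
    (μ : Module.Dual K M) (ν : Module.Dual K N) :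
    contract (dualTmul μ ν) (coactTensor ρ σ (m ⊗ₜ[K] n)) =
      contract μ (ρ m) ⊗ₜ[K] contract ν (σ n) := by
  rw [coactTensor_tmul]
  generalize ρ m = s, σ n = t
  induction s with
  | zero => simp
  | add _ _ h₁ h₂ => simp only [map_add, TensorProduct.add_tmul, h₁, h₂]
  | tmul a m =>
    induction t with
    | zero => simp
    | add _ _ h₁ h₂ => simp only [map_add, TensorProduct.tmul_add, h₁, h₂]
    | tmul b n => simp [TensorProduct.smul_tmul', smul_smul, mul_comm]

/-- The tensor product of two linear forms on different modules acts factorwise. -/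
theorem hat_coactTensor (ρ : M →ₗ[K] A ⊗[K] M) (σ : N →ₗ[K] B ⊗[K] N) (α : A →ₗ[K] K)
    (β : B →ₗ[K] K) :
    hat (coactTensor ρ σ) ((TensorProduct.lid K K).toLinearMap ∘ₗ TensorProduct.map α β) =
      TensorProduct.map (hat ρ α) (hat σ β) := by
  refine TensorProduct.ext' fun m n => ?_
  simp only [hat, coactTensor_tmul, LinearMap.comp_apply, TensorProduct.map_tmul]
  generalize ρ m = s, σ n = t
  induction s with
  | zero => simp
  | add _ _ h₁ h₂ => simp only [map_add, TensorProduct.add_tmul, h₁, h₂]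
  | tmul a m =>
    induction t with
    | zero => simp
    | add _ _ h₁ h₂ => simp only [map_add, TensorProduct.tmul_add, h₁, h₂]
    | tmul b n => simp [TensorProduct.smul_tmul', smul_smul, mul_comm]

/-- Turns a form precomposed with a product, such as `ω (m ⊗ H ⊗ H)`, into the action of the form
itself on the target of `e`. -/
theorem Intertwines.hat_comp {f : A →ₗ[K] B} {e : M →ₗ[K] N} {ρ : M →ₗ[K] A ⊗[K] M}
    {σ : N →ₗ[K] B ⊗[K] N} (h : Intertwines f e ρ σ) (α : B →ₗ[K] K) :
    e ∘ₗ hat ρ (α ∘ₗ f) = hat σ α ∘ₗ e := by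
  ext m
  simp only [hat, LinearMap.comp_apply, ← h.apply]
  generalize ρ m = t
  induction t with
  | zero => simp
  | add _ _ h₁ h₂ => simp only [map_add, h₁, h₂]
  | tmul => simp

/-- The coefficients of a family of maps `M i → A ⊗ M i` span `A`. -/
def Generates {ι : Type*} {M : ι → Type*} [∀ i, AddCommGroup (M i)] [∀ i, Module K (M i)]
    (ρ : ∀ i, M i →ₗ[K] A ⊗[K] M i) : Prop :=
  Submodule.span K {a | ∃ i m μ, a = contract μ (ρ i m)} = ⊤

section

variable {ι : Type*} {M : ι → Type*} [∀ i, AddCommGroup (M i)] [∀ i, Module K (M i)]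
  {ρ : ∀ i, M i →ₗ[K] A ⊗[K] M i} {κ : Type*} {N : κ → Type*} [∀ i, AddCommGroup (N i)]
  [∀ i, Module K (N i)] {σ : ∀ i, N i →ₗ[K] B ⊗[K] N i}

/-- The uniqueness half of the correspondence `ϑ`, in a form that also applies to tensor powers. -/
theorem Generates.hom_ext (h : Generates ρ) {f g : A →ₗ[K] V}
    (hfg : ∀ i, f.rTensor (M i) ∘ₗ ρ i = g.rTensor (M i) ∘ₗ ρ i) : f = g := by
  refine LinearMap.ext_on h ?_
  rintro _ ⟨i, m, μ, rfl⟩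
  rw [← contract_rTensor, ← contract_rTensor]
  exact congrArg _ (LinearMap.congr_fun (hfg i) m)

theorem Generates.form_ext (h : Generates ρ) {α β : A →ₗ[K] K}
    (hαβ : ∀ i, hat (ρ i) α = hat (ρ i) β) : α = β := by
  refine LinearMap.ext_on h ?_
  rintro _ ⟨i, m, μ, rfl⟩
  rw [← dual_hat, ← dual_hat, hαβ]

/-- A tensor product of two coefficients is a coefficient of the tensor product map, with respect to
a pure form. -/
theorem Generates.tensor (h : Generates ρ) (h' : Generates σ) :
    Generates (fun i : ι × κ => coactTensor (ρ i.1) (σ i.2)) := by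
  rw [Generates, eq_top_iff, ← TensorProduct.span_tmul_eq_top, Submodule.span_le]
  rintro _ ⟨a, b, rfl⟩
  have ha : a ∈ Submodule.span K {a | ∃ i m μ, a = contract μ (ρ i m)} := h ▸ Submodule.mem_top
  have hb : b ∈ Submodule.span K {a | ∃ i m μ, a = contract μ (σ i m)} := h' ▸ Submodule.mem_top
  have := Submodule.apply_mem_map₂ (TensorProduct.mk K A B) ha hb
  rw [Submodule.map₂_span_span] at this
  refine Submodule.span_mono ?_ this
  rintro _ ⟨_, ⟨i, m, μ, rfl⟩, _, ⟨j, n, ν, rfl⟩, rfl⟩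
  exact ⟨(i, j), m ⊗ₜ[K] n, dualTmul μ ν, (contract_coactTensor ..).symm⟩

end

/-! ### Coactions of coalgebras and convolution -/

section Coalgebra

variable [Coalgebra K A] [Coalgebra K B]

/-- A coassociative and counital coaction. -/
structure IsCoaction (ρ : M →ₗ[K] A ⊗[K] M) : Prop where
  coassoc : (Coalgebra.comul (R := K) (A := A)).rTensor M ∘ₗ ρ =
    (TensorProduct.assoc K A A M).symm.toLinearMap ∘ₗ ρ.lTensor A ∘ₗ ρ
  counit : hat ρ (Coalgebra.counit (R := K) (A := A)) = LinearMap.id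

theorem IsCoaction.coassoc_apply {ρ : M →ₗ[K] A ⊗[K] M} (h : IsCoaction ρ) (m : M) :
    (Coalgebra.comul (R := K) (A := A)).rTensor M (ρ m) =
      (TensorProduct.assoc K A A M).symm (ρ.lTensor A (ρ m)) :=
  LinearMap.congr_fun h.coassoc m

/-- By coassociativity the first Sweedler leg comes from the outer coaction, so `α` acts on `M`
before `f` is applied. -/
theorem IsCoaction.rTensor_convLeft {ρ : M →ₗ[K] A ⊗[K] M} (h : IsCoaction ρ) (α : A →ₗ[K] K)
    (f : A →ₗ[K] V) : (convLeft α f).rTensor M ∘ₗ ρ = (f.rTensor M ∘ₗ ρ) ∘ₗ hat ρ α := by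
  ext m
  simp only [convLeft, LinearMap.rTensor_comp, LinearMap.comp_apply, h.coassoc_apply, hat]
  generalize ρ m = t
  induction t with
  | zero => simp
  | add _ _ h₁ h₂ => simp only [map_add, h₁, h₂]
  | tmul a m =>
    simp only [LinearMap.lTensor_tmul, LinearMap.rTensor_tmul, LinearEquiv.coe_coe,
      TensorProduct.lid_tmul, map_smul]
    generalize ρ m = t
    induction t with
    | zero => simp
    | add _ _ h₁ h₂ => simp only [map_add, TensorProduct.tmul_add, smul_add, h₁, h₂]
    | tmul a m => simp [TensorProduct.smul_tmul']

/-- Here the form takes the second Sweedler leg, which comes from the inner coaction, so it acts on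
`M` last. -/
theorem IsCoaction.rTensor_convRight {ρ : M →ₗ[K] A ⊗[K] M} (h : IsCoaction ρ) (α : A →ₗ[K] K)
    (f : A →ₗ[K] V) :
    (convRight f α).rTensor M ∘ₗ ρ = (hat ρ α).lTensor V ∘ₗ f.rTensor M ∘ₗ ρ := by
  ext m
  simp only [convRight, LinearMap.rTensor_comp, LinearMap.comp_apply, h.coassoc_apply, hat]
  generalize ρ m = t
  induction t with
  | zero => simp
  | add _ _ h₁ h₂ => simp only [map_add, h₁, h₂]
  | tmul a m =>
    simp only [LinearMap.lTensor_tmul, LinearMap.rTensor_tmul, LinearMap.lTensor_comp,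
      LinearMap.comp_apply]
    generalize ρ m = t
    induction t with
    | zero => simp
    | add _ _ h₁ h₂ => simp only [map_add, TensorProduct.tmul_add, h₁, h₂]
    | tmul a m => simp [TensorProduct.smul_tmul]

theorem IsCoaction.hat_convLeft {ρ : M →ₗ[K] A ⊗[K] M} (h : IsCoaction ρ) (α β : A →ₗ[K] K) :
    hat ρ (convLeft α β) = hat ρ β ∘ₗ hat ρ α := by
  rw [hat, h.rTensor_convLeft]; rfl

theorem IsCoaction.comul_contract {ρ : M →ₗ[K] A ⊗[K] M} (h : IsCoaction ρ) (m : M)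
    (μ : Module.Dual K M) :
    Coalgebra.comul (R := K) (contract μ (ρ m)) = (contract μ ∘ₗ ρ).lTensor A (ρ m) := by
  rw [← contract_rTensor, h.coassoc_apply]
  simp only [LinearMap.lTensor_comp, LinearMap.comp_apply]
  generalize ρ.lTensor A (ρ m) = t
  induction t with
  | zero => simp
  | add _ _ h₁ h₂ => simp only [map_add, h₁, h₂]
  | tmul a t =>
    induction t with
    | zero => simp
    | add _ _ h₁ h₂ => simp only [map_add, TensorProduct.tmul_add, h₁, h₂]
    | tmul b m => simp

theorem IsCoaction.counit_contract {ρ : M →ₗ[K] A ⊗[K] M} (h : IsCoaction ρ) (m : M)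
    (μ : Module.Dual K M) : Coalgebra.counit (R := K) (contract μ (ρ m)) = μ m := by
  rw [← dual_hat, h.counit]; rfl

/-- The comultiplication of a matrix coalgebra: this is coassociativity read off on coefficients,
with a dual basis inserted in the middle. -/
theorem IsCoaction.comul_contract_eq_sum {ρ : M →ₗ[K] A ⊗[K] M} (h : IsCoaction ρ)
    {ι : Type*} [Fintype ι] {e : ι → M} {e' : ι → Module.Dual K M}
    (he : ∀ x, ∑ i, e' i x • e i = x) (m : M) (μ : Module.Dual K M) :
    Coalgebra.comul (R := K) (contract μ (ρ m)) =
      ∑ i, contract (e' i) (ρ m) ⊗ₜ[K] contract μ (ρ (e i)) := by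
  rw [h.comul_contract]
  conv_lhs => rw [← sum_contract_tmul he (ρ m)]
  simp

theorem IsCoaction.tensor {ρ : M →ₗ[K] A ⊗[K] M} {σ : N →ₗ[K] B ⊗[K] N} (hρ : IsCoaction ρ)
    (hσ : IsCoaction σ) : IsCoaction (coactTensor ρ σ) where
  counit := by
    have : (Coalgebra.counit (R := K) (A := A ⊗[K] B)) =
        (TensorProduct.lid K K).toLinearMap ∘ₗ
          TensorProduct.map Coalgebra.counit Coalgebra.counit := by
      ext; simp [mul_comm]
    rw [this, hat_coactTensor, hρ.counit, hσ.counit, TensorProduct.map_id]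
  coassoc := by
    -- Both sides of coassociativity are the image under the shuffle `Θ` of the corresponding sides
    -- for `ρ` and `σ`.
    let Θ : ((A ⊗[K] A) ⊗[K] M) ⊗[K] ((B ⊗[K] B) ⊗[K] N) →ₗ[K]
        ((A ⊗[K] B) ⊗[K] (A ⊗[K] B)) ⊗[K] (M ⊗[K] N) :=
      (TensorProduct.tensorTensorTensorComm K A A B B).toLinearMap.rTensor (M ⊗[K] N) ∘ₗ
        (TensorProduct.tensorTensorTensorComm K (A ⊗[K] A) M (B ⊗[K] B) N).toLinearMap
    refine TensorProduct.ext' fun m n => ?_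
    trans Θ ((Coalgebra.comul (R := K) (A := A)).rTensor M (ρ m) ⊗ₜ[K]
      (Coalgebra.comul (R := K) (A := B)).rTensor N (σ n))
    · simp only [LinearMap.comp_apply, coactTensor_tmul]
      generalize ρ m = s, σ n = t
      induction s with
      | zero => simp
      | add _ _ h₁ h₂ => simp only [map_add, TensorProduct.add_tmul, h₁, h₂]
      | tmul a m =>
        induction t with
        | zero => simp
        | add _ _ h₁ h₂ => simp only [map_add, TensorProduct.tmul_add, h₁, h₂]
        | tmul b n => simp [Θ, TensorProduct.comul_tmul]; rfl
    · rw [hρ.coassoc_apply, hσ.coassoc_apply]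
      simp only [LinearMap.comp_apply, coactTensor_tmul]
      generalize ρ m = s, σ n = t
      induction s with
      | zero => simp
      | add _ _ h₁ h₂ => simp only [map_add, TensorProduct.add_tmul, h₁, h₂]
      | tmul a m =>
        induction t with
        | zero => simp
        | add _ _ h₁ h₂ => simp only [map_add, TensorProduct.tmul_add, h₁, h₂]
        | tmul b n =>
          simp only [LinearMap.lTensor_tmul, TensorProduct.tensorTensorTensorComm_tmul,
            coactTensor_tmul]
          generalize ρ m = s, σ n = t
          induction s with
          | zero => simp
          | add _ _ h₁ h₂ => simp only [map_add, TensorProduct.add_tmul, TensorProduct.tmul_add,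
              h₁, h₂]
          | tmul a m =>
            induction t with
            | zero => simp
            | add _ _ h₁ h₂ => simp only [map_add, TensorProduct.tmul_add, h₁, h₂]
            | tmul b n => simp [Θ]

/-- A linear map that intertwines, along isomorphisms, a generating family of coactions with
coactions is compatible with the comultiplications. -/
theorem Generates.comul_comp {ι : Type*} {M N : ι → Type*} [∀ i, AddCommGroup (M i)]
    [∀ i, Module K (M i)] [∀ i, AddCommGroup (N i)] [∀ i, Module K (N i)]
    {ρ : ∀ i, M i →ₗ[K] A ⊗[K] M i} {σ : ∀ i, N i →ₗ[K] B ⊗[K] N i} (hρ : Generates ρ)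
    (hρ' : ∀ i, IsCoaction (ρ i)) (hσ : ∀ i, IsCoaction (σ i)) {f : A →ₗ[K] B}
    (e : ∀ i, M i ≃ₗ[K] N i) (h : ∀ i, Intertwines f (e i).toLinearMap (ρ i) (σ i)) :
    Coalgebra.comul (R := K) ∘ₗ f = TensorProduct.map f f ∘ₗ Coalgebra.comul (R := K) := by
  refine hρ.hom_ext fun i => ?_
  ext m
  apply (LinearEquiv.lTensor (B ⊗[K] B) (e i)).injective
  -- After transport along `e i`, both sides become the two expressions for the iterated coaction `σ
  -- i` at `e i m`.
  trans (Coalgebra.comul (R := K) (A := B)).rTensor (N i) (σ i (e i m))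
  · rw [← LinearEquiv.coe_coe (e i), ← (h i).apply]
    simp only [LinearMap.comp_apply]
    generalize ρ i m = t
    induction t with
    | zero => simp
    | add _ _ h₁ h₂ => simp only [map_add, h₁, h₂]
    | tmul => simp
  · rw [(hσ i).coassoc_apply, ← LinearEquiv.coe_coe (e i), ← (h i).apply, LinearMap.comp_apply,
      LinearMap.rTensor_comp, LinearMap.comp_apply, (hρ' i).coassoc_apply]
    generalize ρ i m = t
    induction t with
    | zero => simp
    | add _ _ h₁ h₂ => simp only [map_add, h₁, h₂]
    | tmul a m =>
      simp only [LinearMap.lTensor_tmul, TensorProduct.map_tmul, ← (h i).apply]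
      generalize ρ i m = t
      induction t with
      | zero => simp
      | add _ _ h₁ h₂ => simp only [map_add, TensorProduct.tmul_add, h₁, h₂]
      | tmul => simp

/-- The form `ε ∘ f` acts on `M i` as the conjugate under `e i` of the action of `ε` on `N i`, that
is, as the identity. -/
theorem Generates.counit_comp {ι : Type*} {M N : ι → Type*} [∀ i, AddCommGroup (M i)]
    [∀ i, Module K (M i)] [∀ i, AddCommGroup (N i)] [∀ i, Module K (N i)]
    {ρ : ∀ i, M i →ₗ[K] A ⊗[K] M i} {σ : ∀ i, N i →ₗ[K] B ⊗[K] N i} (hρ : Generates ρ)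
    (hρ' : ∀ i, IsCoaction (ρ i)) (hσ : ∀ i, IsCoaction (σ i)) {f : A →ₗ[K] B}
    (e : ∀ i, M i ≃ₗ[K] N i) (h : ∀ i, Intertwines f (e i).toLinearMap (ρ i) (σ i)) :
    Coalgebra.counit (R := K) ∘ₗ f = Coalgebra.counit (R := K) := by
  refine hρ.form_ext fun i => ?_
  have := (h i).hat_comp (Coalgebra.counit (R := K))
  rw [(hσ i).counit] at this
  rw [(hρ' i).counit]
  ext m
  exact (e i).injective (LinearMap.congr_fun this m)

end Coalgebra

end Comodule

/-! ### The universal property of the coend and its coalgebra structure -/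

section Coend

variable {K : Type w} [CommRing K] {C : Type u} [Category.{v} C] {F : C ⥤ ModuleCat.{w} K}
  {V : Type*} [AddCommGroup V] [Module K V]

theorem coendι_comp_map {X Y : C} (f : X ⟶ Y) (x : F.obj X) (ψ : Module.Dual K (F.obj Y)) :
    coendι F X (x ⊗ₜ[K] (ψ ∘ₗ (F.map f).hom)) = coendι F Y ((F.map f).hom x ⊗ₜ[K] ψ) := by
  simp only [coendι, LinearMap.comp_apply, Submodule.mkQ_apply]
  rw [Submodule.Quotient.eq]
  exact Submodule.subset_span ⟨X, Y, f, x, ψ, rfl⟩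

/-- The linear map on the coend defined by a dinatural family. -/
noncomputable def coendLift (g : ∀ X : C, F.obj X ⊗[K] Module.Dual K (F.obj X) →ₗ[K] V)
    (hg : ∀ {X Y : C} (f : X ⟶ Y) (x : F.obj X) (ψ : Module.Dual K (F.obj Y)),
      g X (x ⊗ₜ[K] (ψ ∘ₗ (F.map f).hom)) = g Y ((F.map f).hom x ⊗ₜ[K] ψ)) :
    Coend F →ₗ[K] V :=
  open Classical in
  (coendRel F).liftQ (DirectSum.toModule K C V g) <| by
    rw [coendRel, Submodule.span_le]
    rintro _ ⟨X, Y, f, x, ψ, rfl⟩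
    simp only [SetLike.mem_coe, LinearMap.mem_ker, map_sub, coendGen, DirectSum.toModule_lof,
      hg f x ψ, sub_self]

@[simp] theorem coendLift_coendι (g : ∀ X : C, F.obj X ⊗[K] Module.Dual K (F.obj X) →ₗ[K] V)
    (hg : ∀ {X Y : C} (f : X ⟶ Y) (x : F.obj X) (ψ : Module.Dual K (F.obj Y)),
      g X (x ⊗ₜ[K] (ψ ∘ₗ (F.map f).hom)) = g Y ((F.map f).hom x ⊗ₜ[K] ψ)) (X : C)
    (p : F.obj X ⊗[K] Module.Dual K (F.obj X)) : coendLift g hg (coendι F X p) = g X p := by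
  simp only [coendLift, coendι, LinearMap.comp_apply, Submodule.mkQ_apply, Submodule.liftQ_apply,
    DirectSum.toModule_lof]

variable (F) in
theorem span_coendι :
    Submodule.span K {a : Coend F | ∃ X x ψ, a = coendι F X (x ⊗ₜ[K] ψ)} = ⊤ := by
  classical
  rw [eq_top_iff]
  rintro a -
  obtain ⟨t, rfl⟩ := (coendRel F).mkQ_surjective a
  induction t using DirectSum.induction_on with
  | zero => simp
  | add _ _ h₁ h₂ => rw [map_add]; exact add_mem h₁ h₂
  | of X p =>
    induction p with
    | zero => simp
    | add _ _ h₁ h₂ => simp only [map_add]; exact add_mem h₁ h₂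
    | tmul x ψ =>
      refine Submodule.subset_span ⟨X, x, ψ, ?_⟩
      simp only [coendι, LinearMap.comp_apply]
      congr!

/-- The coend over an essentially small category is small. -/
theorem small_coend [EssentiallySmall.{w} C] : Small.{w} (Coend F) := by
  -- The generators living on a small model of `C` form a small family; it remains to see that they
  -- span.
  let G := (equivSmallModel.{w} C).inverse
  let T := Σ s : SmallModel.{w} C, F.obj (G.obj s) × Module.Dual K (F.obj (G.obj s))
  let v : T → Coend F := fun t => coendι F _ (t.2.1 ⊗ₜ[K] t.2.2)
  have hv : LinearMap.range (Finsupp.linearCombination K v) = ⊤ := by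
    rw [Finsupp.range_linearCombination, eq_top_iff, ← span_coendι F]
    refine Submodule.span_mono ?_
    rintro _ ⟨X, x, ψ, rfl⟩
    -- The dinaturality relation for this isomorphism moves a generator at `X` to one at an object
    -- of the small model.
    let i : X ≅ G.obj ((equivSmallModel.{w} C).functor.obj X) :=
      (equivSmallModel.{w} C).unitIso.app X
    refine ⟨⟨_, (F.map i.hom).hom x, ψ ∘ₗ (F.map i.inv).hom⟩, ?_⟩
    simp only [v, ← coendι_comp_map, LinearMap.comp_assoc, ← ModuleCat.hom_comp, ← F.map_comp]
    simp
  exact small_of_surjective (LinearMap.range_eq_top.mp hv)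

/-- The linear map on `H ⊗ H` defined by a family that is dinatural in two variables. -/
theorem exists_coend_lift₂ (g : ∀ X Y : C, (F.obj X ⊗[K] Module.Dual K (F.obj X)) ⊗[K]
      (F.obj Y ⊗[K] Module.Dual K (F.obj Y)) →ₗ[K] V)
    (h₁ : ∀ {X X' : C} (f : X ⟶ X') (x : F.obj X) (ψ : Module.Dual K (F.obj X')) (Y : C) q,
      g X Y ((x ⊗ₜ[K] (ψ ∘ₗ (F.map f).hom)) ⊗ₜ[K] q) =
        g X' Y (((F.map f).hom x ⊗ₜ[K] ψ) ⊗ₜ[K] q))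
    (h₂ : ∀ {Y Y' : C} (f : Y ⟶ Y') (y : F.obj Y) (ψ : Module.Dual K (F.obj Y')) (X : C) p,
      g X Y (p ⊗ₜ[K] (y ⊗ₜ[K] (ψ ∘ₗ (F.map f).hom))) =
        g X Y' (p ⊗ₜ[K] ((F.map f).hom y ⊗ₜ[K] ψ))) :
    ∃ f : Coend F ⊗[K] Coend F →ₗ[K] V, ∀ X Y p q,
      f (coendι F X p ⊗ₜ[K] coendι F Y q) = g X Y (p ⊗ₜ[K] q) := by
  -- Curry and descend in one variable at a time: here in `Y`, with values in linear maps on the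
  -- summand at `X`, and afterwards in `X`.
  let G (X : C) : Coend F →ₗ[K] (F.obj X ⊗[K] Module.Dual K (F.obj X)) →ₗ[K] V :=
    coendLift (fun Y => (TensorProduct.curry (g X Y)).flip) fun f y ψ => LinearMap.ext fun p => h₂ f y ψ X p
  refine ⟨TensorProduct.lift (coendLift (fun X => (G X).flip) fun {X X'} f x ψ => ?_), ?_⟩
  · refine LinearMap.ext_on (span_coendι F) ?_
    rintro _ ⟨Y, y, χ, rfl⟩
    simp [G, h₁]
  · intro X Y p q
    simp [G]

/-- For fixed `X` the two-variable case applies with values in linear maps on the summand at `X`;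
then one descends in `X`. -/
theorem exists_coend_lift₃ (g : ∀ X Y Z : C, (F.obj X ⊗[K] Module.Dual K (F.obj X)) ⊗[K]
      ((F.obj Y ⊗[K] Module.Dual K (F.obj Y)) ⊗[K]
        (F.obj Z ⊗[K] Module.Dual K (F.obj Z))) →ₗ[K] V)
    (h₁ : ∀ {X X' : C} (f : X ⟶ X') (x : F.obj X) (ψ : Module.Dual K (F.obj X')) (Y Z : C) q r,
      g X Y Z ((x ⊗ₜ[K] (ψ ∘ₗ (F.map f).hom)) ⊗ₜ[K] (q ⊗ₜ[K] r)) =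
        g X' Y Z (((F.map f).hom x ⊗ₜ[K] ψ) ⊗ₜ[K] (q ⊗ₜ[K] r)))
    (h₂ : ∀ {Y Y' : C} (f : Y ⟶ Y') (y : F.obj Y) (ψ : Module.Dual K (F.obj Y')) (X Z : C) p r,
      g X Y Z (p ⊗ₜ[K] ((y ⊗ₜ[K] (ψ ∘ₗ (F.map f).hom)) ⊗ₜ[K] r)) =
        g X Y' Z (p ⊗ₜ[K] (((F.map f).hom y ⊗ₜ[K] ψ) ⊗ₜ[K] r)))
    (h₃ : ∀ {Z Z' : C} (f : Z ⟶ Z') (z : F.obj Z) (ψ : Module.Dual K (F.obj Z')) (X Y : C) p q,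
      g X Y Z (p ⊗ₜ[K] (q ⊗ₜ[K] (z ⊗ₜ[K] (ψ ∘ₗ (F.map f).hom)))) =
        g X Y Z' (p ⊗ₜ[K] (q ⊗ₜ[K] ((F.map f).hom z ⊗ₜ[K] ψ)))) :
    ∃ f : Coend F ⊗[K] (Coend F ⊗[K] Coend F) →ₗ[K] V, ∀ X Y Z p q r,
      f (coendι F X p ⊗ₜ[K] (coendι F Y q ⊗ₜ[K] coendι F Z r)) =
        g X Y Z (p ⊗ₜ[K] (q ⊗ₜ[K] r)) := by
  have (X : C) := exists_coend_lift₂ (fun Y Z => (TensorProduct.curry (g X Y Z)).flip)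
    (fun f y ψ Z r => LinearMap.ext fun p => h₂ f y ψ X Z p r)
    (fun f z ψ Y q => LinearMap.ext fun p => h₃ f z ψ X Y p q)
  choose G hG using this
  refine ⟨TensorProduct.lift (coendLift (fun X => (G X).flip) fun {X X'} f x ψ => ?_), ?_⟩
  · refine TensorProduct.ext ?_
    refine LinearMap.ext_on (span_coendι F) ?_
    rintro _ ⟨Y, y, χ, rfl⟩
    refine LinearMap.ext_on (span_coendι F) ?_
    rintro _ ⟨Z, z, ζ, rfl⟩
    simp [hG, h₁]
  · intro X Y Z p q r
    simp [hG]

/-- The shuffle `(M ⊗ M^*) ⊗ (N ⊗ N^*) → (M ⊗ N) ⊗ (M ⊗ N)^*`. -/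
noncomputable def dualShuffle (M N : Type*) [AddCommGroup M] [Module K M] [AddCommGroup N] [Module K N] :
    (M ⊗[K] Module.Dual K M) ⊗[K] (N ⊗[K] Module.Dual K N) →ₗ[K]
      (M ⊗[K] N) ⊗[K] Module.Dual K (M ⊗[K] N) :=
  (TensorProduct.dualDistrib K M N).lTensor (M ⊗[K] N) ∘ₗ
    (TensorProduct.tensorTensorTensorComm K M (Module.Dual K M) N (Module.Dual K N)).toLinearMap

@[simp] theorem dualShuffle_tmul {M N : Type*} [AddCommGroup M] [Module K M] [AddCommGroup N]
    [Module K N] (m : M) (μ : Module.Dual K M) (n : N) (ν : Module.Dual K N) :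
    dualShuffle M N ((m ⊗ₜ[K] μ) ⊗ₜ[K] (n ⊗ₜ[K] ν)) = (m ⊗ₜ[K] n) ⊗ₜ[K] dualTmul μ ν := by
  simp [dualShuffle]

variable [∀ X, Module.Finite K (F.obj X)] [∀ X, Module.Projective K (F.obj X)]

/-- Identifies the generators of the coend with the matrix coefficients of `δ`, which makes the
coefficient calculus available. -/
theorem contract_coendCoact (X : C) (x : F.obj X) (ψ : Module.Dual K (F.obj X)) :
    contract ψ (coendCoact F X x) = coendι F X (x ⊗ₜ[K] ψ) := by
  simp only [coendCoact, LinearMap.comp_apply, contract_rTensor, LinearMap.flip_apply,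
    TensorProduct.mk_apply, LinearEquiv.coe_coe]
  congr 1
  -- The dual basis element enters only through the endomorphism it represents, so the computation
  -- is done for an arbitrary tensor `d`.
  obtain ⟨d, hd⟩ : ∃ d, d = (dualTensorHomEquiv K (F.obj X) (F.obj X)).symm LinearMap.id :=
    ⟨_, rfl⟩
  have hd' : dualTensorHom K (F.obj X) (F.obj X) d = LinearMap.id := by
    rw [hd]; exact (dualTensorHomEquiv K (F.obj X) (F.obj X)).apply_symm_apply _
  have key : ∀ d : Module.Dual K (F.obj X) ⊗[K] F.obj X,
      contract ψ ((TensorProduct.assoc K (F.obj X) (Module.Dual K (F.obj X)) (F.obj X)).symm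
        (x ⊗ₜ[K] d)) = x ⊗ₜ[K] (ψ ∘ₗ dualTensorHom K (F.obj X) (F.obj X) d) := by
    intro d
    induction d with
    | zero => simp
    | add _ _ h₁ h₂ => simp only [map_add, TensorProduct.tmul_add, LinearMap.comp_add, h₁, h₂]
    | tmul θ y =>
      simp only [TensorProduct.assoc_symm_tmul, contract_tmul, ← TensorProduct.tmul_smul]
      congr 1
      ext z
      simp [mul_comm]
  rw [← hd, key, hd', LinearMap.comp_id]

variable (F) in
theorem generates_coendCoact : Generates (coendCoact F) := by
  rw [Generates, ← span_coendι F]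
  simp only [contract_coendCoact]

variable (F) in
theorem generates_coactTensor₃ : Generates fun i : C × (C × C) =>
    coactTensor (coendCoact F i.1) (coactTensor (coendCoact F i.2.1) (coendCoact F i.2.2)) :=
  (generates_coendCoact F).tensor (N := fun i : C × C => F.obj i.1 ⊗[K] F.obj i.2)
    (σ := fun i => coactTensor (coendCoact F i.1) (coendCoact F i.2))
    ((generates_coendCoact F).tensor (generates_coendCoact F))

variable (F) in
theorem generates_coactTensor₄ : Generates fun i : C × (C × (C × C)) =>
    coactTensor (coendCoact F i.1) (coactTensor (coendCoact F i.2.1)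
      (coactTensor (coendCoact F i.2.2.1) (coendCoact F i.2.2.2))) :=
  (generates_coendCoact F).tensor
    (N := fun i : C × (C × C) => F.obj i.1 ⊗[K] (F.obj i.2.1 ⊗[K] F.obj i.2.2))
    (σ := fun i => coactTensor (coendCoact F i.1)
      (coactTensor (coendCoact F i.2.1) (coendCoact F i.2.2)))
    (generates_coactTensor₃ F)

/-- Colinearity of `F f` is the dinaturality relation of the coend, read on coefficients. -/
theorem lTensor_map_coendCoact {X Y : C} (f : X ⟶ Y) :
    (F.map f).hom.lTensor (Coend F) ∘ₗ coendCoact F X = coendCoact F Y ∘ₗ (F.map f).hom := by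
  ext x
  refine contract_ext fun ψ => ?_
  simp only [LinearMap.comp_apply, contract_lTensor, contract_coendCoact, coendι_comp_map]

theorem intertwines_map {X Y : C} (f : X ⟶ Y) :
    Intertwines LinearMap.id (F.map f).hom (coendCoact F X) (coendCoact F Y) :=
  lTensor_map_coendCoact f

variable (F) in
/-- The inverse of `ϑ_V`. -/
theorem exists_theta_eq (ξ : ∀ X : C, F.obj X →ₗ[K] V ⊗[K] F.obj X)
    (hξ : ∀ {X Y : C} (f : X ⟶ Y), (F.map f).hom.lTensor V ∘ₗ ξ X = ξ Y ∘ₗ (F.map f).hom) :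
    ∃ f : Coend F →ₗ[K] V, ∀ X, theta F f X = ξ X := by
  -- Naturality of `ξ` says that its matrix coefficients form a dinatural family.
  refine ⟨coendLift (fun X => coeff (ξ X)) fun {X Y} f x ψ => ?_, fun X => ?_⟩
  · have := LinearMap.congr_fun (hξ f) x
    simp only [LinearMap.comp_apply] at this
    rw [coeff_tmul, coeff_tmul, ← this, contract_lTensor]
  · ext x
    refine contract_ext fun ψ => ?_
    simp [theta, contract_rTensor, contract_coendCoact]

variable (F) in
/-- The inverse of `ϑ²_V`. -/
theorem exists_theta₂_eq (ξ : ∀ X Y : C, F.obj X ⊗[K] F.obj Y →ₗ[K] V ⊗[K] (F.obj X ⊗[K] F.obj Y))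
    (hξ : ∀ {X X' Y Y' : C} (f : X ⟶ X') (g : Y ⟶ Y'),
      (TensorProduct.map (F.map f).hom (F.map g).hom).lTensor V ∘ₗ ξ X Y =
        ξ X' Y' ∘ₗ TensorProduct.map (F.map f).hom (F.map g).hom) :
    ∃ f : Coend F ⊗[K] Coend F →ₗ[K] V, ∀ X Y, theta₂ F f X Y = ξ X Y := by
  have hξ' {X X' Y Y' : C} (f : X ⟶ X') (g : Y ⟶ Y') (t : F.obj X ⊗[K] F.obj Y) :
      (TensorProduct.map (F.map f).hom (F.map g).hom).lTensor V (ξ X Y t) =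
        ξ X' Y' (TensorProduct.map (F.map f).hom (F.map g).hom t) :=
    LinearMap.congr_fun (hξ f g) t
  -- The shuffle restricts the coefficients of `ξ` to pure forms, and these already determine `ξ`.
  obtain ⟨f, hf⟩ := exists_coend_lift₂ (F := F) (fun X Y => coeff (ξ X Y) ∘ₗ dualShuffle _ _)
    (fun {X X'} f x ψ Y q => by
      induction q with
      | zero => simp
      | add _ _ h₁ h₂ => simp only [map_add, TensorProduct.tmul_add, h₁, h₂]
      | tmul y χ =>
        have := hξ' f (𝟙 Y) (x ⊗ₜ[K] y)
        simp only [TensorProduct.map_tmul, F.map_id, ModuleCat.hom_id, LinearMap.id_apply] at this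
        simp only [LinearMap.comp_apply, dualShuffle_tmul, coeff_tmul, ← this, contract_lTensor,
          dualTmul_comp_map, LinearMap.comp_id])
    (fun {Y Y'} f y χ X p => by
      induction p with
      | zero => simp
      | add _ _ h₁ h₂ => simp only [map_add, TensorProduct.add_tmul, h₁, h₂]
      | tmul x ψ =>
        have := hξ' (𝟙 X) f (x ⊗ₜ[K] y)
        simp only [TensorProduct.map_tmul, F.map_id, ModuleCat.hom_id, LinearMap.id_apply] at this
        simp only [LinearMap.comp_apply, dualShuffle_tmul, coeff_tmul, ← this, contract_lTensor,
          dualTmul_comp_map, LinearMap.comp_id])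
  refine ⟨f, fun X Y => ?_⟩
  refine TensorProduct.ext' fun x y => ?_
  refine contract_dualTmul_ext fun ψ χ => ?_
  simp only [theta₂, LinearMap.comp_apply, contract_rTensor, contract_coactTensor,
    contract_coendCoact, hf, dualShuffle_tmul, coeff_tmul]

variable (F) in
/-- The inverse of `ϑ³_V`. -/
theorem exists_theta₃_eq (ξ : ∀ X Y Z : C, F.obj X ⊗[K] (F.obj Y ⊗[K] F.obj Z) →ₗ[K]
      V ⊗[K] (F.obj X ⊗[K] (F.obj Y ⊗[K] F.obj Z)))
    (hξ : ∀ {X X' Y Y' Z Z' : C} (f : X ⟶ X') (g : Y ⟶ Y') (h : Z ⟶ Z'),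
      (TensorProduct.map (F.map f).hom
          (TensorProduct.map (F.map g).hom (F.map h).hom)).lTensor V ∘ₗ ξ X Y Z =
        ξ X' Y' Z' ∘ₗ
          TensorProduct.map (F.map f).hom (TensorProduct.map (F.map g).hom (F.map h).hom)) :
    ∃ f : Coend F ⊗[K] (Coend F ⊗[K] Coend F) →ₗ[K] V,
      ∀ X Y Z, theta₃ F f X Y Z = ξ X Y Z := by
  have hξ' {X X' Y Y' Z Z' : C} (f : X ⟶ X') (g : Y ⟶ Y') (h : Z ⟶ Z')
      (t : F.obj X ⊗[K] (F.obj Y ⊗[K] F.obj Z)) :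
      (TensorProduct.map (F.map f).hom
          (TensorProduct.map (F.map g).hom (F.map h).hom)).lTensor V (ξ X Y Z t) =
        ξ X' Y' Z' (TensorProduct.map (F.map f).hom
          (TensorProduct.map (F.map g).hom (F.map h).hom) t) :=
    LinearMap.congr_fun (hξ f g h) t
  let g (X Y Z : C) : (F.obj X ⊗[K] Module.Dual K (F.obj X)) ⊗[K]
      ((F.obj Y ⊗[K] Module.Dual K (F.obj Y)) ⊗[K]
        (F.obj Z ⊗[K] Module.Dual K (F.obj Z))) →ₗ[K] V :=
    coeff (ξ X Y Z) ∘ₗ dualShuffle _ _ ∘ₗ (dualShuffle _ _).lTensor _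
  have hg (X Y Z : C) (x : F.obj X) (y : F.obj Y) (z : F.obj Z) ψ χ ζ :
      g X Y Z ((x ⊗ₜ[K] ψ) ⊗ₜ[K] ((y ⊗ₜ[K] χ) ⊗ₜ[K] (z ⊗ₜ[K] ζ))) =
        contract (dualTmul ψ (dualTmul χ ζ)) (ξ X Y Z (x ⊗ₜ[K] (y ⊗ₜ[K] z))) := by
    simp only [g, LinearMap.comp_apply, LinearMap.lTensor_tmul, dualShuffle_tmul, coeff_tmul]
  have nat {X X' Y Y' Z Z' : C} (f₁ : X ⟶ X') (f₂ : Y ⟶ Y') (f₃ : Z ⟶ Z') (x : F.obj X)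
      (y : F.obj Y) (z : F.obj Z) ψ χ ζ :
      g X Y Z ((x ⊗ₜ[K] (ψ ∘ₗ (F.map f₁).hom)) ⊗ₜ[K] ((y ⊗ₜ[K] (χ ∘ₗ (F.map f₂).hom)) ⊗ₜ[K]
          (z ⊗ₜ[K] (ζ ∘ₗ (F.map f₃).hom)))) =
        g X' Y' Z' (((F.map f₁).hom x ⊗ₜ[K] ψ) ⊗ₜ[K] (((F.map f₂).hom y ⊗ₜ[K] χ) ⊗ₜ[K]
          ((F.map f₃).hom z ⊗ₜ[K] ζ))) := by
    have := hξ' f₁ f₂ f₃ (x ⊗ₜ[K] (y ⊗ₜ[K] z))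
    simp only [TensorProduct.map_tmul] at this
    rw [hg, hg, ← this, contract_lTensor, dualTmul_comp_map, dualTmul_comp_map]
  obtain ⟨f, hf⟩ := exists_coend_lift₃ g
    (fun {X X'} f x ψ Y Z q r => by
      induction q with
      | zero => simp
      | add _ _ h₁ h₂ => simp only [map_add, TensorProduct.add_tmul, TensorProduct.tmul_add, h₁, h₂]
      | tmul y χ =>
        induction r with
        | zero => simp
        | add _ _ h₁ h₂ => simp only [map_add, TensorProduct.tmul_add, h₁, h₂]
        | tmul z ζ => simpa using nat f (𝟙 Y) (𝟙 Z) x y z ψ χ ζ)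
    (fun {Y Y'} f y χ X Z p r => by
      induction p with
      | zero => simp
      | add _ _ h₁ h₂ => simp only [map_add, TensorProduct.add_tmul, h₁, h₂]
      | tmul x ψ =>
        induction r with
        | zero => simp
        | add _ _ h₁ h₂ => simp only [map_add, TensorProduct.tmul_add, h₁, h₂]
        | tmul z ζ => simpa using nat (𝟙 X) f (𝟙 Z) x y z ψ χ ζ)
    (fun {Z Z'} f z ζ X Y p q => by
      induction p with
      | zero => simp
      | add _ _ h₁ h₂ => simp only [map_add, TensorProduct.add_tmul, h₁, h₂]
      | tmul x ψ =>
        induction q with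
        | zero => simp
        | add _ _ h₁ h₂ =>
          simp only [map_add, TensorProduct.add_tmul, TensorProduct.tmul_add, h₁, h₂]
        | tmul y χ => simpa using nat (𝟙 X) (𝟙 Y) f x y z ψ χ ζ)
  refine ⟨f, fun X Y Z => LinearMap.ext fun t => ?_⟩
  induction t with
  | zero => simp
  | add _ _ h₁ h₂ => simp only [map_add, h₁, h₂]
  | tmul x t =>
    induction t with
    | zero => simp
    | add _ _ h₁ h₂ => simp only [map_add, TensorProduct.tmul_add, h₁, h₂]
    | tmul y z =>
      refine contract_dualTmul₃_ext fun ψ χ ζ => ?_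
      simp only [theta₃, LinearMap.comp_apply, contract_rTensor]
      rw [contract_coactTensor _ _ _ _ _ (dualTmul χ ζ), contract_coactTensor]
      simp only [contract_coendCoact, hf, hg]

variable (F) in
-- The case `V = K`: every natural endomorphism of `F X ⊗ F Y ⊗ F Z` is the action of a linear form.
-- It produces both `ω` and its inverse.
theorem exists_form_eq (W : ∀ X Y Z : C, F.obj X ⊗[K] (F.obj Y ⊗[K] F.obj Z) →ₗ[K]
      F.obj X ⊗[K] (F.obj Y ⊗[K] F.obj Z))
    (hW : ∀ {X X' Y Y' Z Z' : C} (f : X ⟶ X') (g : Y ⟶ Y') (h : Z ⟶ Z'),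
      TensorProduct.map (F.map f).hom (TensorProduct.map (F.map g).hom (F.map h).hom) ∘ₗ W X Y Z =
        W X' Y' Z' ∘ₗ
          TensorProduct.map (F.map f).hom (TensorProduct.map (F.map g).hom (F.map h).hom)) :
    ∃ α : Coend F ⊗[K] (Coend F ⊗[K] Coend F) →ₗ[K] K, ∀ X Y Z,
      hat (coactTensor (coendCoact F X) (coactTensor (coendCoact F Y) (coendCoact F Z))) α =
        W X Y Z := by
  obtain ⟨α, hα⟩ := exists_theta₃_eq F
    (fun X Y Z => (TensorProduct.lid K _).symm.toLinearMap ∘ₗ W X Y Z) (fun f g h => by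
      rw [LinearMap.comp_assoc, ← hW f g h]
      refine LinearMap.ext fun t => ?_
      simp)
  refine ⟨α, fun X Y Z => ?_⟩
  have h := hα X Y Z
  rw [theta₃] at h
  rw [hat, h]
  refine LinearMap.ext fun t => ?_
  simp

/-- Convolution acts by composition and the counit acts as the identity, so inverse actions come
from convolution inverse forms. -/
theorem convLeft_eq_counit [Coalgebra K (Coend F)] (hA : ∀ X, IsCoaction (coendCoact F X))
    {α β : Coend F ⊗[K] (Coend F ⊗[K] Coend F) →ₗ[K] K}
    (h : ∀ X Y Z, hat (coactTensor (coendCoact F X)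
          (coactTensor (coendCoact F Y) (coendCoact F Z))) β ∘ₗ
        hat (coactTensor (coendCoact F X)
          (coactTensor (coendCoact F Y) (coendCoact F Z))) α = LinearMap.id) :
    convLeft α β = Coalgebra.counit := by
  refine (generates_coactTensor₃ F).form_ext fun i => ?_
  have hi := (hA i.1).tensor ((hA i.2.1).tensor (hA i.2.2))
  rw [hi.hat_convLeft, hi.counit, h]

variable (F) in
set_option maxHeartbeats 1000000 in
/-- The coend is a coalgebra that coacts on all modules `F X` by `δ`. -/
theorem exists_coalgebra_coend : ∃ _ : Coalgebra K (Coend F), ∀ X, IsCoaction (coendCoact F X) := by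
  obtain ⟨Δ, hΔ⟩ := exists_theta_eq F
    (fun X => (TensorProduct.assoc K (Coend F) (Coend F) (F.obj X)).symm.toLinearMap ∘ₗ
      (coendCoact F X).lTensor (Coend F) ∘ₗ coendCoact F X) (fun {X Y} f => by
        ext x
        simp only [LinearMap.comp_apply]
        have h := LinearMap.congr_fun (lTensor_map_coendCoact f) x
        simp only [LinearMap.comp_apply] at h
        rw [← h]
        generalize coendCoact F X x = t
        induction t with
        | zero => simp
        | add _ _ h₁ h₂ => simp only [map_add, h₁, h₂]
        | tmul a x =>
          simp only [LinearMap.lTensor_tmul]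
          have h := LinearMap.congr_fun (lTensor_map_coendCoact f) x
          simp only [LinearMap.comp_apply] at h
          rw [← h]
          generalize coendCoact F X x = t
          induction t with
          | zero => simp
          | add _ _ h₁ h₂ => simp only [map_add, TensorProduct.tmul_add, h₁, h₂]
          | tmul => simp)
  obtain ⟨ε, hε⟩ := exists_theta_eq F (V := K)
    (fun X => (TensorProduct.lid K (F.obj X)).symm.toLinearMap) (fun f => by ext; simp)
  -- The matrix formula for `Δ` has to be extracted from its defining equation, because the
  -- coalgebra axioms are proved from it.
  have hΔ' (X : C) (x : F.obj X) (ψ : Module.Dual K (F.obj X)) :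
      Δ (contract ψ (coendCoact F X x)) =
        (contract ψ ∘ₗ coendCoact F X).lTensor (Coend F) (coendCoact F X x) := by
    have h := LinearMap.congr_fun (hΔ X) x
    simp only [theta, LinearMap.comp_apply] at h
    rw [← contract_rTensor, h]
    simp only [LinearMap.lTensor_comp, LinearMap.comp_apply]
    generalize (coendCoact F X).lTensor (Coend F) (coendCoact F X x) = t
    induction t with
    | zero => simp
    | add _ _ h₁ h₂ => simp only [map_add, h₁, h₂]
    | tmul a t =>
      induction t with
      | zero => simp
      | add _ _ h₁ h₂ => simp only [map_add, TensorProduct.tmul_add, h₁, h₂]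
      | tmul b m => simp
  have hε' (X : C) : hat (coendCoact F X) ε = LinearMap.id := by
    have h := hε X
    simp only [theta] at h
    rw [hat, h]
    ext; simp
  have hΔs (X : C) {n : ℕ} {e : Fin n → F.obj X} {e' : Fin n → Module.Dual K (F.obj X)}
      (he : ∀ x, ∑ i, e' i x • e i = x) (x : F.obj X) (ψ : Module.Dual K (F.obj X)) :
      Δ (contract ψ (coendCoact F X x)) =
        ∑ i, contract (e' i) (coendCoact F X x) ⊗ₜ[K] contract ψ (coendCoact F X (e i)) := by
    rw [hΔ']
    conv_lhs => rw [← sum_contract_tmul he (coendCoact F X x)]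
    simp
  let A : Coalgebra K (Coend F) :=
    { comul := Δ, counit := ε, coassoc := ?_, rTensor_counit_comp_comul := ?_,
      lTensor_counit_comp_comul := ?_ }
  · exact ⟨A, fun X => ⟨hΔ X, hε' X⟩⟩
  -- On a coefficient both sides of coassociativity are the same double sum over a dual basis, up to
  -- the order of summation.
  · refine LinearMap.ext_on (generates_coendCoact F) ?_
    rintro _ ⟨X, x, ψ, rfl⟩
    obtain ⟨n, e, e', he⟩ := exists_dual_basis K (F.obj X)
    simp only [LinearMap.comp_apply, hΔs X he, map_sum, LinearMap.rTensor_tmul,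
      LinearMap.lTensor_tmul, TensorProduct.sum_tmul, TensorProduct.tmul_sum, LinearEquiv.coe_coe,
      TensorProduct.assoc_tmul]
    rw [Finset.sum_comm]
  · refine LinearMap.ext_on (generates_coendCoact F) ?_
    rintro _ ⟨X, x, ψ, rfl⟩
    obtain ⟨n, e, e', he⟩ := exists_dual_basis K (F.obj X)
    simp only [LinearMap.comp_apply, hΔs X he, map_sum, LinearMap.rTensor_tmul,
      ← dual_hat, hε', LinearMap.id_apply, TensorProduct.mk_apply]
    conv_rhs => rw [← he x]
    simp only [map_sum, map_smul, TensorProduct.tmul_sum, TensorProduct.tmul_smul,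
      TensorProduct.smul_tmul', smul_eq_mul, mul_one]
  · refine LinearMap.ext_on (generates_coendCoact F) ?_
    rintro _ ⟨X, x, ψ, rfl⟩
    obtain ⟨n, e, e', he⟩ := exists_dual_basis K (F.obj X)
    simp only [LinearMap.comp_apply, hΔs X he, map_sum, LinearMap.lTensor_tmul,
      ← dual_hat, hε', LinearMap.id_apply, LinearMap.flip_apply, TensorProduct.mk_apply]
    conv_rhs => rw [← sum_contract_tmul he (coendCoact F X x)]
    simp only [map_sum, contract_tmul, TensorProduct.sum_tmul, TensorProduct.smul_tmul,
      smul_eq_mul, mul_one]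

end Coend

/-! ### Constraints of the category transported through a quasi-monoidal functor -/

section Reconstruction

variable {K : Type w} [CommRing K] {C : Type u} [Category.{v} C] [MonoidalCategory C]
  {F : C ⥤ ModuleCat.{w} K}

namespace QuasiMonoidal

variable (φ : QuasiMonoidal F)

theorem tensorEquiv_map {X X' Y Y' : C} (f : X ⟶ X') (g : Y ⟶ Y') (x : F.obj X) (y : F.obj Y) :
    φ.tensorEquiv X' Y' ((F.map f).hom x ⊗ₜ[K] (F.map g).hom y) =
      (F.map (f ⊗ₘ g)).hom (φ.tensorEquiv X Y (x ⊗ₜ[K] y)) :=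
  LinearMap.congr_fun (congrArg ModuleCat.Hom.hom (φ.naturality f g)) (x ⊗ₜ[K] y)

theorem tensorEquiv_comp_map {X X' Y Y' : C} (f : X ⟶ X') (g : Y ⟶ Y') :
    (φ.tensorEquiv X' Y').toLinearMap ∘ₗ TensorProduct.map (F.map f).hom (F.map g).hom =
      (F.map (f ⊗ₘ g)).hom ∘ₗ (φ.tensorEquiv X Y).toLinearMap :=
  TensorProduct.ext' fun x y => φ.tensorEquiv_map f g x y

theorem tensorEquiv_map_left {X X' : C} (f : X ⟶ X') (Y : C) (x : F.obj X) (y : F.obj Y) :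
    φ.tensorEquiv X' Y ((F.map f).hom x ⊗ₜ[K] y) =
      (F.map (f ▷ Y)).hom (φ.tensorEquiv X Y (x ⊗ₜ[K] y)) := by
  simpa using φ.tensorEquiv_map f (𝟙 Y) x y

theorem tensorEquiv_map_right (X : C) {Y Y' : C} (g : Y ⟶ Y') (x : F.obj X) (y : F.obj Y) :
    φ.tensorEquiv X Y' (x ⊗ₜ[K] (F.map g).hom y) =
      (F.map (X ◁ g)).hom (φ.tensorEquiv X Y (x ⊗ₜ[K] y)) := by
  simpa using φ.tensorEquiv_map (𝟙 X) g x y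

/-- The isomorphism `F X ⊗ (F Y ⊗ F Z) → F ((X ⊗ Y) ⊗ Z)`. -/
noncomputable def leftEquiv (X Y Z : C) :
    F.obj X ⊗[K] (F.obj Y ⊗[K] F.obj Z) ≃ₗ[K] F.obj ((X ⊗ Y) ⊗ Z) :=
  (TensorProduct.assoc K (F.obj X) (F.obj Y) (F.obj Z)).symm ≪≫ₗ
    (φ.tensorEquiv X Y).rTensor (F.obj Z) ≪≫ₗ φ.tensorEquiv (X ⊗ Y) Z

/-- The isomorphism `F X ⊗ (F Y ⊗ F Z) → F (X ⊗ (Y ⊗ Z))`. -/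
noncomputable def rightEquiv (X Y Z : C) :
    F.obj X ⊗[K] (F.obj Y ⊗[K] F.obj Z) ≃ₗ[K] F.obj (X ⊗ (Y ⊗ Z)) :=
  (φ.tensorEquiv Y Z).lTensor (F.obj X) ≪≫ₗ φ.tensorEquiv X (Y ⊗ Z)

@[simp] theorem leftEquiv_tmul (X Y Z : C) (x : F.obj X) (y : F.obj Y) (z : F.obj Z) :
    φ.leftEquiv X Y Z (x ⊗ₜ[K] (y ⊗ₜ[K] z)) =
      φ.tensorEquiv (X ⊗ Y) Z (φ.tensorEquiv X Y (x ⊗ₜ[K] y) ⊗ₜ[K] z) := rfl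

theorem rightEquiv_tmul (X Y Z : C) (x : F.obj X) (t : F.obj Y ⊗[K] F.obj Z) :
    φ.rightEquiv X Y Z (x ⊗ₜ[K] t) =
      φ.tensorEquiv X (Y ⊗ Z) (x ⊗ₜ[K] φ.tensorEquiv Y Z t) := rfl

/-- The automorphism of `F X ⊗ (F Y ⊗ F Z)` that corresponds to `F (a⁻¹)`. -/
noncomputable def reassocEquiv (X Y Z : C) :
    F.obj X ⊗[K] (F.obj Y ⊗[K] F.obj Z) ≃ₗ[K] F.obj X ⊗[K] (F.obj Y ⊗[K] F.obj Z) :=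
  φ.rightEquiv X Y Z ≪≫ₗ (F.mapIso (α_ X Y Z).symm).toLinearEquiv ≪≫ₗ (φ.leftEquiv X Y Z).symm

theorem leftEquiv_reassocEquiv (X Y Z : C) (t : F.obj X ⊗[K] (F.obj Y ⊗[K] F.obj Z)) :
    φ.leftEquiv X Y Z (φ.reassocEquiv X Y Z t) =
      (F.map (α_ X Y Z).inv).hom (φ.rightEquiv X Y Z t) := by
  simp only [reassocEquiv, LinearEquiv.trans_apply, LinearEquiv.apply_symm_apply]
  rfl

theorem leftEquiv_comp_reassocEquiv (X Y Z : C) :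
    (φ.leftEquiv X Y Z).toLinearMap ∘ₗ (φ.reassocEquiv X Y Z).toLinearMap =
      (F.map (α_ X Y Z).inv).hom ∘ₗ (φ.rightEquiv X Y Z).toLinearMap :=
  LinearMap.ext fun t => φ.leftEquiv_reassocEquiv X Y Z t

/-- Combines naturality of the two iterated forms of `φ` with naturality of the associator; it is
what allows the family to define a form. -/
theorem reassocEquiv_naturality {X X' Y Y' Z Z' : C} (f : X ⟶ X') (g : Y ⟶ Y') (h : Z ⟶ Z') :
    TensorProduct.map (F.map f).hom (TensorProduct.map (F.map g).hom (F.map h).hom) ∘ₗ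
        (φ.reassocEquiv X Y Z).toLinearMap =
      (φ.reassocEquiv X' Y' Z').toLinearMap ∘ₗ
        TensorProduct.map (F.map f).hom (TensorProduct.map (F.map g).hom (F.map h).hom) := by
  have hl (t) : φ.leftEquiv X' Y' Z' (TensorProduct.map (F.map f).hom
      (TensorProduct.map (F.map g).hom (F.map h).hom) t) =
        (F.map ((f ⊗ₘ g) ⊗ₘ h)).hom (φ.leftEquiv X Y Z t) := by
    induction t with
    | zero => simp
    | add _ _ h₁ h₂ => simp only [map_add, h₁, h₂]
    | tmul x t =>
      induction t with
      | zero => simp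
      | add _ _ h₁ h₂ => simp only [map_add, TensorProduct.tmul_add, h₁, h₂]
      | tmul y z =>
        simp only [TensorProduct.map_tmul, leftEquiv_tmul, tensorEquiv_map]
  have hr (t) : φ.rightEquiv X' Y' Z' (TensorProduct.map (F.map f).hom
      (TensorProduct.map (F.map g).hom (F.map h).hom) t) =
        (F.map (f ⊗ₘ (g ⊗ₘ h))).hom (φ.rightEquiv X Y Z t) := by
    induction t with
    | zero => simp
    | add _ _ h₁ h₂ => simp only [map_add, h₁, h₂]
    | tmul x t =>
      induction t with
      | zero => simp
      | add _ _ h₁ h₂ => simp only [map_add, TensorProduct.tmul_add, h₁, h₂]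
      | tmul y z =>
        simp only [TensorProduct.map_tmul, rightEquiv_tmul, tensorEquiv_map]
  refine LinearMap.ext fun t => ?_
  apply (φ.leftEquiv X' Y' Z').injective
  simp only [LinearMap.comp_apply, LinearEquiv.coe_coe, hl, leftEquiv_reassocEquiv, hr]
  simp only [← LinearMap.comp_apply, ← ModuleCat.hom_comp, ← F.map_comp,
    associator_inv_naturality]

theorem IsNeutral.map_leftUnitor {φ : QuasiMonoidal F} (hφ : φ.IsNeutral) (X : C) (k : K)
    (x : F.obj X) :
    (F.map (λ_ X).hom).hom (φ.tensorEquiv (𝟙_ C) X (φ.unitEquiv k ⊗ₜ[K] x)) = k • x :=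
  LinearMap.congr_fun (congrArg ModuleCat.Hom.hom (hφ.left_unit X)) (k ⊗ₜ[K] x)

theorem IsNeutral.map_rightUnitor {φ : QuasiMonoidal F} (hφ : φ.IsNeutral) (X : C) (k : K)
    (x : F.obj X) :
    (F.map (ρ_ X).hom).hom (φ.tensorEquiv X (𝟙_ C) (x ⊗ₜ[K] φ.unitEquiv k)) = k • x :=
  LinearMap.congr_fun (congrArg ModuleCat.Hom.hom (hφ.right_unit X)) (x ⊗ₜ[K] k)

theorem IsNeutral.tensorEquiv_one_left {φ : QuasiMonoidal F} (hφ : φ.IsNeutral) (X : C)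
    (x : F.obj X) :
    φ.tensorEquiv (𝟙_ C) X (φ.unitEquiv 1 ⊗ₜ[K] x) = (F.map (λ_ X).inv).hom x := by
  conv_rhs => rw [← one_smul K x, ← hφ.map_leftUnitor, ← LinearMap.comp_apply,
    ← ModuleCat.hom_comp, ← F.map_comp]
  simp

theorem IsNeutral.tensorEquiv_one_right {φ : QuasiMonoidal F} (hφ : φ.IsNeutral) (X : C)
    (x : F.obj X) :
    φ.tensorEquiv X (𝟙_ C) (x ⊗ₜ[K] φ.unitEquiv 1) = (F.map (ρ_ X).inv).hom x := by
  conv_rhs => rw [← one_smul K x, ← hφ.map_rightUnitor, ← LinearMap.comp_apply,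
    ← ModuleCat.hom_comp, ← F.map_comp]
  simp

/-- Neutrality turns `φ` at the unit vector into `F` of inverse unitors; the claim is then the
triangle axiom. -/
theorem IsNeutral.reassocEquiv_one {φ : QuasiMonoidal F} (hφ : φ.IsNeutral) (X Z : C)
    (x : F.obj X) (z : F.obj Z) :
    φ.reassocEquiv X (𝟙_ C) Z (x ⊗ₜ[K] (φ.unitEquiv 1 ⊗ₜ[K] z)) =
      x ⊗ₜ[K] (φ.unitEquiv 1 ⊗ₜ[K] z) := by
  apply (φ.leftEquiv X (𝟙_ C) Z).injective
  rw [leftEquiv_reassocEquiv, rightEquiv_tmul, leftEquiv_tmul, hφ.tensorEquiv_one_left,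
    hφ.tensorEquiv_one_right, tensorEquiv_map_left, tensorEquiv_map_right]
  simp only [← LinearMap.comp_apply, ← ModuleCat.hom_comp, ← F.map_comp]
  simp

/-- The pentagon axiom, transported to `F X ⊗ (F Y ⊗ (F Z ⊗ F W))`. -/
theorem reassocEquiv_pentagon (X Y Z W : C)
    {h₁ h₂ h₃ h₄ : F.obj X ⊗[K] (F.obj Y ⊗[K] (F.obj Z ⊗[K] F.obj W)) →ₗ[K]
      F.obj X ⊗[K] (F.obj Y ⊗[K] (F.obj Z ⊗[K] F.obj W))}
    (H₁ : ((φ.tensorEquiv Z W).toLinearMap.lTensor (F.obj Y)).lTensor (F.obj X) ∘ₗ h₁ =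
      (φ.reassocEquiv X Y (Z ⊗ W)).toLinearMap ∘ₗ
        ((φ.tensorEquiv Z W).toLinearMap.lTensor (F.obj Y)).lTensor (F.obj X))
    (H₂ : ((φ.tensorEquiv X Y).toLinearMap.rTensor (F.obj Z ⊗[K] F.obj W) ∘ₗ
        (TensorProduct.assoc K _ _ _).symm.toLinearMap) ∘ₗ h₂ =
      (φ.reassocEquiv (X ⊗ Y) Z W).toLinearMap ∘ₗ
        (φ.tensorEquiv X Y).toLinearMap.rTensor (F.obj Z ⊗[K] F.obj W) ∘ₗ
          (TensorProduct.assoc K _ _ _).symm.toLinearMap)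
    (H₃ : ((φ.tensorEquiv Y Z).toLinearMap.rTensor (F.obj W) ∘ₗ
        (TensorProduct.assoc K _ _ _).symm.toLinearMap).lTensor (F.obj X) ∘ₗ h₃ =
      (φ.reassocEquiv X (Y ⊗ Z) W).toLinearMap ∘ₗ
        ((φ.tensorEquiv Y Z).toLinearMap.rTensor (F.obj W) ∘ₗ
          (TensorProduct.assoc K _ _ _).symm.toLinearMap).lTensor (F.obj X))
    (H₄ : ((TensorProduct.assoc K (F.obj X) (F.obj Y ⊗[K] F.obj Z) (F.obj W)).symm.toLinearMap ∘ₗ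
        (TensorProduct.assoc K _ _ _).symm.toLinearMap.lTensor (F.obj X)) ∘ₗ h₄ =
      (φ.reassocEquiv X Y Z).toLinearMap.rTensor (F.obj W) ∘ₗ
        (TensorProduct.assoc K (F.obj X) (F.obj Y ⊗[K] F.obj Z) (F.obj W)).symm.toLinearMap ∘ₗ
          (TensorProduct.assoc K _ _ _).symm.toLinearMap.lTensor (F.obj X)) :
    h₂ ∘ₗ h₁ = h₄ ∘ₗ h₃ ∘ₗ (φ.reassocEquiv Y Z W).toLinearMap.lTensor (F.obj X) := by
  have ext₄ {V : Type w} [AddCommGroup V] [Module K V]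
      {f g : F.obj X ⊗[K] (F.obj Y ⊗[K] (F.obj Z ⊗[K] F.obj W)) →ₗ[K] V}
      (h : ∀ x y z w, f (x ⊗ₜ[K] (y ⊗ₜ[K] (z ⊗ₜ[K] w))) = g (x ⊗ₜ[K] (y ⊗ₜ[K] (z ⊗ₜ[K] w)))) :
      f = g := by
    refine TensorProduct.ext (LinearMap.ext fun x => TensorProduct.ext (LinearMap.ext fun y =>
      TensorProduct.ext' fun z w => ?_))
    exact h x y z w
  -- The maps `e₁` to `e₄` regroup the fourfold tensor product, merging two neighbouring factors by
  -- `φ` or only rebracketing.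
  set e₁ := ((φ.tensorEquiv Z W).toLinearMap.lTensor (F.obj Y)).lTensor (F.obj X) with he₁
  set e₂ := (φ.tensorEquiv X Y).toLinearMap.rTensor (F.obj Z ⊗[K] F.obj W) ∘ₗ
    (TensorProduct.assoc K _ _ _).symm.toLinearMap with he₂
  set e₃ := ((φ.tensorEquiv Y Z).toLinearMap.rTensor (F.obj W) ∘ₗ
    (TensorProduct.assoc K _ _ _).symm.toLinearMap).lTensor (F.obj X) with he₃
  set e₄ := (TensorProduct.assoc K (F.obj X) (F.obj Y ⊗[K] F.obj Z) (F.obj W)).symm.toLinearMap ∘ₗ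
    (TensorProduct.assoc K _ _ _).symm.toLinearMap.lTensor (F.obj X) with he₄
  -- The two ways to assemble four factors by `φ` with a given bracketing agree, by definition on
  -- pure tensors.
  have A₁ : (φ.rightEquiv (X ⊗ Y) Z W).toLinearMap ∘ₗ e₂ =
      (φ.leftEquiv X Y (Z ⊗ W)).toLinearMap ∘ₗ e₁ := ext₄ fun x y z w => rfl
  have A₂ : (φ.tensorEquiv X (Y ⊗ (Z ⊗ W))).toLinearMap ∘ₗ
      (φ.rightEquiv Y Z W).toLinearMap.lTensor (F.obj X) =
        (φ.rightEquiv X Y (Z ⊗ W)).toLinearMap ∘ₗ e₁ := ext₄ fun x y z w => rfl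
  have A₃ : (φ.rightEquiv X (Y ⊗ Z) W).toLinearMap ∘ₗ e₃ =
      (φ.tensorEquiv X ((Y ⊗ Z) ⊗ W)).toLinearMap ∘ₗ
        (φ.leftEquiv Y Z W).toLinearMap.lTensor (F.obj X) := ext₄ fun x y z w => rfl
  have A₄ : (φ.leftEquiv X (Y ⊗ Z) W).toLinearMap ∘ₗ e₃ =
      (φ.tensorEquiv (X ⊗ (Y ⊗ Z)) W).toLinearMap ∘ₗ
        (φ.rightEquiv X Y Z).toLinearMap.rTensor (F.obj W) ∘ₗ e₄ := ext₄ fun x y z w => rfl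
  have A₅ : (φ.leftEquiv (X ⊗ Y) Z W).toLinearMap ∘ₗ e₂ =
      (φ.tensorEquiv ((X ⊗ Y) ⊗ Z) W).toLinearMap ∘ₗ
        (φ.leftEquiv X Y Z).toLinearMap.rTensor (F.obj W) ∘ₗ e₄ := ext₄ fun x y z w => rfl
  have N₁ (t) : φ.tensorEquiv X ((Y ⊗ Z) ⊗ W) ((F.map (α_ Y Z W).inv).hom.lTensor (F.obj X) t) =
      (F.map (X ◁ (α_ Y Z W).inv)).hom (φ.tensorEquiv X (Y ⊗ (Z ⊗ W)) t) := by
    induction t with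
    | zero => simp
    | add _ _ h₁ h₂ => simp only [map_add, h₁, h₂]
    | tmul x y => exact φ.tensorEquiv_map_right ..
  have N₂ (t) : φ.tensorEquiv ((X ⊗ Y) ⊗ Z) W ((F.map (α_ X Y Z).inv).hom.rTensor (F.obj W) t) =
      (F.map ((α_ X Y Z).inv ▷ W)).hom (φ.tensorEquiv (X ⊗ (Y ⊗ Z)) W t) := by
    induction t with
    | zero => simp
    | add _ _ h₁ h₂ => simp only [map_add, h₁, h₂]
    | tmul x y => exact φ.tensorEquiv_map_left ..
  -- Each of `B₁` to `B₅` identifies one map with `F` of one edge of the pentagon.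
  have B₁ (t) : φ.leftEquiv X Y (Z ⊗ W) (e₁ (h₁ t)) =
      (F.map (α_ X Y (Z ⊗ W)).inv).hom (φ.rightEquiv X Y (Z ⊗ W) (e₁ t)) :=
    (congrArg _ (LinearMap.congr_fun H₁ t)).trans (φ.leftEquiv_reassocEquiv ..)
  have B₂ (t) : φ.leftEquiv (X ⊗ Y) Z W (e₂ (h₂ t)) =
      (F.map (α_ (X ⊗ Y) Z W).inv).hom (φ.rightEquiv (X ⊗ Y) Z W (e₂ t)) :=
    (congrArg _ (LinearMap.congr_fun H₂ t)).trans (φ.leftEquiv_reassocEquiv ..)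
  have B₃ (t) : φ.leftEquiv X (Y ⊗ Z) W (e₃ (h₃ t)) =
      (F.map (α_ X (Y ⊗ Z) W).inv).hom (φ.rightEquiv X (Y ⊗ Z) W (e₃ t)) :=
    (congrArg _ (LinearMap.congr_fun H₃ t)).trans (φ.leftEquiv_reassocEquiv ..)
  have B₄ (t) : φ.leftEquiv (X ⊗ Y) Z W (e₂ (h₄ t)) =
      (F.map ((α_ X Y Z).inv ▷ W)).hom (φ.leftEquiv X (Y ⊗ Z) W (e₃ t)) := by
    refine (LinearMap.congr_fun A₅ (h₄ t)).trans ?_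
    refine Eq.trans ?_ (congrArg _ (LinearMap.congr_fun A₄ t).symm)
    refine Eq.trans ?_ (N₂ _)
    simp only [LinearMap.comp_apply, LinearEquiv.coe_coe]
    congr 1
    refine (congrArg _ (LinearMap.congr_fun H₄ t)).trans ?_
    rw [← LinearMap.comp_apply (LinearMap.rTensor _ _) (LinearMap.rTensor _ _),
      ← LinearMap.rTensor_comp, ← leftEquiv_comp_reassocEquiv, LinearMap.rTensor_comp]
    rfl
  have B₅ (t) : φ.rightEquiv X (Y ⊗ Z) W (e₃
      ((φ.reassocEquiv Y Z W).toLinearMap.lTensor (F.obj X) t)) =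
      (F.map (X ◁ (α_ Y Z W).inv)).hom (φ.rightEquiv X Y (Z ⊗ W) (e₁ t)) := by
    refine (LinearMap.congr_fun A₃ _).trans ?_
    refine Eq.trans ?_ (congrArg _ (LinearMap.congr_fun A₂ t))
    refine Eq.trans ?_ (N₁ _)
    simp only [LinearMap.comp_apply, LinearEquiv.coe_coe]
    congr 1
    rw [← LinearMap.comp_apply (LinearMap.lTensor _ _) (LinearMap.lTensor _ _),
      ← LinearMap.lTensor_comp, leftEquiv_comp_reassocEquiv, LinearMap.lTensor_comp]
    rfl
  have inj : Function.Injective fun t => φ.leftEquiv (X ⊗ Y) Z W (e₂ t) := by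
    refine (φ.leftEquiv (X ⊗ Y) Z W).injective.comp ?_
    exact ((TensorProduct.assoc K _ _ _).symm ≪≫ₗ
      (φ.tensorEquiv X Y).rTensor (F.obj Z ⊗[K] F.obj W)).injective
  refine LinearMap.ext fun t => ?_
  apply inj
  have A₁' (t) : φ.rightEquiv (X ⊗ Y) Z W (e₂ t) = φ.leftEquiv X Y (Z ⊗ W) (e₁ t) :=
    LinearMap.congr_fun A₁ t
  simp only [LinearMap.comp_apply, B₂, A₁', B₁, B₄, B₃, B₅]
  simp only [← LinearMap.comp_apply, ← ModuleCat.hom_comp, ← F.map_comp, Category.assoc,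
    pentagon_inv]

/-- The module `F 𝟙` is free on the vector `φ₀ 1`. -/
theorem contract_unitEquiv_tmul {A : Type*} [AddCommGroup A] [Module K A]
    (t : A ⊗[K] F.obj (𝟙_ C)) :
    contract φ.unitEquiv.symm.toLinearMap t ⊗ₜ[K] φ.unitEquiv 1 = t := by
  induction t with
  | zero => simp
  | add _ _ h₁ h₂ => simp only [map_add, TensorProduct.add_tmul, h₁, h₂]
  | tmul a x =>
    simp only [contract_tmul, TensorProduct.smul_tmul, LinearEquiv.coe_coe, ← map_smul,
      smul_eq_mul, mul_one, LinearEquiv.apply_symm_apply]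

end QuasiMonoidal

end Reconstruction

/-! ### Reassociators acting on tensor products of comodules -/

section Comodule

variable {K : Type*} [CommRing K]
  {A : Type*} [AddCommGroup A] [Module K A] {B : Type*} [AddCommGroup B] [Module K B]
  {M : Type*} [AddCommGroup M] [Module K M] {N : Type*} [AddCommGroup N] [Module K N]

theorem Intertwines.map_contract {f : A →ₗ[K] B} {e : M →ₗ[K] N} {ρ : M →ₗ[K] A ⊗[K] M}
    {σ : N →ₗ[K] B ⊗[K] N} (h : Intertwines f e ρ σ) (ν : Module.Dual K N) (m : M) :
    f (contract (ν ∘ₗ e) (ρ m)) = contract ν (σ (e m)) := by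
  rw [← contract_map, h.apply]

/-- If `w` corresponds to a morphism of coactions, then it intertwines the two maps along which
the coactions were restricted. -/
theorem Intertwines.lTensor_comp_rTensor {f₁ f₂ : A →ₗ[K] B} {ρ : M →ₗ[K] A ⊗[K] M}
    {N₁ N₂ : Type*} [AddCommGroup N₁] [Module K N₁] [AddCommGroup N₂] [Module K N₂]
    {σ₁ : N₁ →ₗ[K] B ⊗[K] N₁} {σ₂ : N₂ →ₗ[K] B ⊗[K] N₂} {e₁ : M →ₗ[K] N₁} {e₂ : M ≃ₗ[K] N₂}
    (h₁ : Intertwines f₁ e₁ ρ σ₁) (h₂ : Intertwines f₂ e₂.toLinearMap ρ σ₂) {g : N₁ →ₗ[K] N₂}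
    (hg : Intertwines LinearMap.id g σ₁ σ₂) {w : M →ₗ[K] M}
    (hw : e₂.toLinearMap ∘ₗ w = g ∘ₗ e₁) :
    w.lTensor B ∘ₗ f₁.rTensor M ∘ₗ ρ = (f₂.rTensor M ∘ₗ ρ) ∘ₗ w := by
  refine LinearMap.ext fun m => ?_
  apply (LinearEquiv.lTensor B e₂).injective
  have hw' (m) : e₂ (w m) = g (e₁ m) := LinearMap.congr_fun hw m
  trans σ₂ (g (e₁ m))
  · rw [← hg.apply, ← h₁.apply]
    simp only [LinearMap.comp_apply]
    generalize ρ m = t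
    induction t with
    | zero => simp
    | add _ _ h₁ h₂ => simp only [map_add, h₁, h₂]
    | tmul => simp [hw']
  · rw [← hw', ← LinearEquiv.coe_coe e₂, ← h₂.apply]
    simp only [LinearMap.comp_apply]
    generalize ρ (w m) = t
    induction t with
    | zero => simp
    | add _ _ h₁ h₂ => simp only [map_add, h₁, h₂]
    | tmul => simp

/-- The action of the two sides of the cocycle condition on a fourfold tensor product. -/
theorem exists_hat_cocycle [Coalgebra K A] {m : A ⊗[K] A →ₗ[K] A}
    {P Q MN NP PQ : Type*} [AddCommGroup P] [Module K P] [AddCommGroup Q] [Module K Q]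
    [AddCommGroup MN] [Module K MN] [AddCommGroup NP] [Module K NP] [AddCommGroup PQ] [Module K PQ]
    {ρ : M →ₗ[K] A ⊗[K] M} {σ : N →ₗ[K] A ⊗[K] N} {τ : P →ₗ[K] A ⊗[K] P} {υ : Q →ₗ[K] A ⊗[K] Q}
    {ρσ : MN →ₗ[K] A ⊗[K] MN} {στ : NP →ₗ[K] A ⊗[K] NP} {τυ : PQ →ₗ[K] A ⊗[K] PQ}
    {e : M ⊗[K] N →ₗ[K] MN} {e' : N ⊗[K] P →ₗ[K] NP} {e'' : P ⊗[K] Q →ₗ[K] PQ}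
    (hρ : IsCoaction ρ) (hσ : IsCoaction σ) (hτ : IsCoaction τ) (hυ : IsCoaction υ)
    (he : Intertwines m e (coactTensor ρ σ) ρσ) (he' : Intertwines m e' (coactTensor σ τ) στ)
    (he'' : Intertwines m e'' (coactTensor τ υ) τυ) (ω : A ⊗[K] (A ⊗[K] A) →ₗ[K] K) :
    ∃ h₁ h₂ h₃ h₄ : M ⊗[K] (N ⊗[K] (P ⊗[K] Q)) →ₗ[K] M ⊗[K] (N ⊗[K] (P ⊗[K] Q)),
      (e''.lTensor N).lTensor M ∘ₗ h₁ =
        hat (coactTensor ρ (coactTensor σ τυ)) ω ∘ₗ (e''.lTensor N).lTensor M ∧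
      (e.rTensor (P ⊗[K] Q) ∘ₗ (TensorProduct.assoc K _ _ _).symm.toLinearMap) ∘ₗ h₂ =
        hat (coactTensor ρσ (coactTensor τ υ)) ω ∘ₗ
          e.rTensor (P ⊗[K] Q) ∘ₗ (TensorProduct.assoc K _ _ _).symm.toLinearMap ∧
      (e'.rTensor Q ∘ₗ (TensorProduct.assoc K _ _ _).symm.toLinearMap).lTensor M ∘ₗ h₃ =
        hat (coactTensor ρ (coactTensor στ υ)) ω ∘ₗ
          (e'.rTensor Q ∘ₗ (TensorProduct.assoc K _ _ _).symm.toLinearMap).lTensor M ∧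
      ((TensorProduct.assoc K M (N ⊗[K] P) Q).symm.toLinearMap ∘ₗ
          (TensorProduct.assoc K N P Q).symm.toLinearMap.lTensor M) ∘ₗ h₄ =
        (hat (coactTensor ρ (coactTensor σ τ)) ω).rTensor Q ∘ₗ
          (TensorProduct.assoc K M (N ⊗[K] P) Q).symm.toLinearMap ∘ₗ
            (TensorProduct.assoc K N P Q).symm.toLinearMap.lTensor M ∧
      hat (coactTensor ρ (coactTensor σ (coactTensor τ υ)))
          (convLeft (ω ∘ₗ (m.lTensor A).lTensor A)
            (ω ∘ₗ m.rTensor (A ⊗[K] A) ∘ₗ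
              (TensorProduct.assoc K A A (A ⊗[K] A)).symm.toLinearMap)) = h₂ ∘ₗ h₁ ∧
      hat (coactTensor ρ (coactTensor σ (coactTensor τ υ)))
          (convLeft ((TensorProduct.lid K K).toLinearMap ∘ₗ TensorProduct.map Coalgebra.counit ω)
            (convLeft
              (ω ∘ₗ (m.rTensor A ∘ₗ
                (TensorProduct.assoc K A A A).symm.toLinearMap).lTensor A)
              ((TensorProduct.lid K K).toLinearMap ∘ₗ TensorProduct.map ω Coalgebra.counit ∘ₗ
                (TensorProduct.assoc K A (A ⊗[K] A) A).symm.toLinearMap ∘ₗ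
                  (TensorProduct.assoc K A A A).symm.toLinearMap.lTensor A))) =
        h₄ ∘ₗ h₃ ∘ₗ (hat (coactTensor σ (coactTensor τ υ)) ω).lTensor M := by
  have hi := hρ.tensor (hσ.tensor (hτ.tensor hυ))
  have rρ := Intertwines.refl ρ
  have rσ := Intertwines.refl σ
  have rυ := Intertwines.refl υ
  have rτυ := Intertwines.refl (coactTensor τ υ)
  have i₀ := hat_coactTensor ρ (coactTensor σ (coactTensor τ υ)) Coalgebra.counit ω
  rw [hρ.counit] at i₀
  have i₄ := ((intertwines_assoc_symm ρ (coactTensor σ τ) υ).comp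
    (rρ.tensor (intertwines_assoc_symm σ τ υ))).hat_comp
      ((TensorProduct.lid K K).toLinearMap ∘ₗ TensorProduct.map ω Coalgebra.counit)
  rw [hat_coactTensor, hυ.counit] at i₄
  -- The four maps are the actions of the pulled-back forms, read off from `Intertwines.hat_comp`.
  refine ⟨_, _, _, _, (rρ.tensor (rσ.tensor he'')).hat_comp ω,
    ((he.tensor rτυ).comp (intertwines_assoc_symm ρ σ (coactTensor τ υ))).hat_comp ω,
    (rρ.tensor ((he'.tensor rυ).comp (intertwines_assoc_symm σ τ υ))).hat_comp ω, i₄,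
    hi.hat_convLeft _ _, ?_⟩
  rw [hi.hat_convLeft, i₀, hi.hat_convLeft]
  rfl

end Comodule

/-! ### Multiplication and unit of the coend -/

section Reconstruction

variable {K : Type w} [CommRing K] {C : Type u} [Category.{v} C] [MonoidalCategory C]
  {F : C ⥤ ModuleCat.{w} K} [∀ X, Module.Finite K (F.obj X)] [∀ X, Module.Projective K (F.obj X)]

namespace QuasiMonoidal

variable (φ : QuasiMonoidal F)

/-- Conjugating `δ` at `X ⊗ Y` by `φ` gives a family natural in both variables, because `φ` is
natural and each `F (f ⊗ g)` is colinear. -/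
theorem exists_mul : ∃ m : Coend F ⊗[K] Coend F →ₗ[K] Coend F, ∀ X Y,
    Intertwines m (φ.tensorEquiv X Y).toLinearMap
      (coactTensor (coendCoact F X) (coendCoact F Y)) (coendCoact F (X ⊗ Y)) := by
  obtain ⟨m, hm⟩ := exists_theta₂_eq F
    (fun X Y => (φ.tensorEquiv X Y).symm.toLinearMap.lTensor (Coend F) ∘ₗ
      coendCoact F (X ⊗ Y) ∘ₗ (φ.tensorEquiv X Y).toLinearMap) (fun {X X' Y Y'} f g => by
        have h := φ.tensorEquiv_comp_map f g
        have h' : TensorProduct.map (F.map f).hom (F.map g).hom ∘ₗ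
            (φ.tensorEquiv X Y).symm.toLinearMap =
              (φ.tensorEquiv X' Y').symm.toLinearMap ∘ₗ (F.map (f ⊗ₘ g)).hom := by
          refine LinearMap.ext fun t => ?_
          apply (φ.tensorEquiv X' Y').injective
          refine (LinearMap.congr_fun h _).trans ?_
          simp
        rw [LinearMap.comp_assoc, LinearMap.comp_assoc, h, ← LinearMap.comp_assoc,
          ← LinearMap.lTensor_comp, h', LinearMap.lTensor_comp, LinearMap.comp_assoc,
          ← LinearMap.comp_assoc _ _ (coendCoact F (X' ⊗ Y')), ← lTensor_map_coendCoact]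
        rfl)
  refine ⟨m, fun X Y => ?_⟩
  have : TensorProduct.map m (φ.tensorEquiv X Y).toLinearMap =
      (φ.tensorEquiv X Y).toLinearMap.lTensor (Coend F) ∘ₗ m.rTensor _ := by
    rw [LinearMap.lTensor_comp_rTensor]
  have h := hm X Y
  rw [theta₂] at h
  rw [Intertwines, this, LinearMap.comp_assoc, h, ← LinearMap.comp_assoc, ← LinearMap.lTensor_comp]
  simp

/-- The unit `1_H` of the coend. -/
noncomputable def coendOne : Coend F :=
  contract φ.unitEquiv.symm.toLinearMap (coendCoact F (𝟙_ C) (φ.unitEquiv 1))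

theorem coendOne_tmul (k : K) :
    φ.coendOne ⊗ₜ[K] φ.unitEquiv k = coendCoact F (𝟙_ C) (φ.unitEquiv k) := by
  have : φ.unitEquiv k = k • φ.unitEquiv 1 := by rw [← map_smul, smul_eq_mul, mul_one]
  rw [this, TensorProduct.tmul_smul, map_smul, coendOne, contract_unitEquiv_tmul]

theorem coact_unit (k : K) :
    coendCoact F (𝟙_ C) (φ.unitEquiv k) = φ.coendOne ⊗ₜ[K] φ.unitEquiv k :=
  (φ.coendOne_tmul k).symm

/-- Products of coefficients are coefficients of `δ` at the tensor product object, after transport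
along `φ`. -/
theorem mul_contract {φ : QuasiMonoidal F} {m : Coend F ⊗[K] Coend F →ₗ[K] Coend F}
    (hm : ∀ X Y, Intertwines m (φ.tensorEquiv X Y).toLinearMap
      (coactTensor (coendCoact F X) (coendCoact F Y)) (coendCoact F (X ⊗ Y)))
    {X Y : C} (μ : Module.Dual K (F.obj X ⊗[K] F.obj Y))
    (t : F.obj X ⊗[K] F.obj Y) :
    m (contract μ (coactTensor (coendCoact F X) (coendCoact F Y) t)) =
      contract (μ ∘ₗ (φ.tensorEquiv X Y).symm.toLinearMap)
        (coendCoact F (X ⊗ Y) (φ.tensorEquiv X Y t)) := by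
  have := (hm X Y).map_contract (μ ∘ₗ (φ.tensorEquiv X Y).symm.toLinearMap) t
  rw [LinearMap.comp_assoc, LinearEquiv.comp_coe, LinearEquiv.self_trans_symm] at this
  exact this

end QuasiMonoidal

end Reconstruction

/-! ### The axioms of the coendomorphism coquasi-bialgebra -/

section Reconstruction

variable {K : Type w} [CommRing K] {C : Type u} [Category.{v} C] [MonoidalCategory C]
  {F : C ⥤ ModuleCat.{w} K} [∀ X, Module.Finite K (F.obj X)] [∀ X, Module.Projective K (F.obj X)]

namespace QuasiMonoidal

variable {φ : QuasiMonoidal F} {m : Coend F ⊗[K] Coend F →ₗ[K] Coend F}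
  {ω : Coend F ⊗[K] (Coend F ⊗[K] Coend F) →ₗ[K] K}

theorem intertwines_rightEquiv (hm : ∀ X Y, Intertwines m (φ.tensorEquiv X Y).toLinearMap
      (coactTensor (coendCoact F X) (coendCoact F Y)) (coendCoact F (X ⊗ Y))) (X Y Z : C) :
    Intertwines (m ∘ₗ m.lTensor (Coend F)) (φ.rightEquiv X Y Z).toLinearMap
      (coactTensor (coendCoact F X) (coactTensor (coendCoact F Y) (coendCoact F Z)))
      (coendCoact F (X ⊗ (Y ⊗ Z))) :=
  (hm X (Y ⊗ Z)).comp ((Intertwines.refl (coendCoact F X)).tensor (hm Y Z))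

theorem intertwines_leftEquiv (hm : ∀ X Y, Intertwines m (φ.tensorEquiv X Y).toLinearMap
      (coactTensor (coendCoact F X) (coendCoact F Y)) (coendCoact F (X ⊗ Y))) (X Y Z : C) :
    Intertwines (m ∘ₗ m.rTensor (Coend F) ∘ₗ (TensorProduct.assoc K _ _ _).symm.toLinearMap)
      (φ.leftEquiv X Y Z).toLinearMap
      (coactTensor (coendCoact F X) (coactTensor (coendCoact F Y) (coendCoact F Z)))
      (coendCoact F ((X ⊗ Y) ⊗ Z)) :=
  (hm (X ⊗ Y) Z).comp (((hm X Y).tensor (Intertwines.refl (coendCoact F Z))).comp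
    (intertwines_assoc_symm _ _ _))

/-- The product is a coefficient of `δ` at `𝟙 ⊗ X`; the colinear map `F (λ⁻¹)` carries it back to
the original coefficient at `X`. -/
theorem mul_coendOne_left (hφ : φ.IsNeutral)
    (hm : ∀ X Y, Intertwines m (φ.tensorEquiv X Y).toLinearMap
      (coactTensor (coendCoact F X) (coendCoact F Y)) (coendCoact F (X ⊗ Y))) (h : Coend F) :
    m (φ.coendOne ⊗ₜ[K] h) = h := by
  suffices m ∘ₗ TensorProduct.mk K _ _ φ.coendOne = LinearMap.id from LinearMap.congr_fun this h
  refine LinearMap.ext_on (generates_coendCoact F) ?_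
  rintro _ ⟨X, x, ψ, rfl⟩
  simp only [LinearMap.comp_apply, TensorProduct.mk_apply, LinearMap.id_apply]
  rw [coendOne, ← contract_coactTensor, mul_contract hm, hφ.tensorEquiv_one_left,
    ← LinearMap.comp_apply (coendCoact F _), ← lTensor_map_coendCoact, LinearMap.comp_apply,
    contract_lTensor]
  congr 2
  refine LinearMap.ext fun y => ?_
  simp [← hφ.tensorEquiv_one_left]

theorem mul_coendOne_right (hφ : φ.IsNeutral)
    (hm : ∀ X Y, Intertwines m (φ.tensorEquiv X Y).toLinearMap
      (coactTensor (coendCoact F X) (coendCoact F Y)) (coendCoact F (X ⊗ Y))) (h : Coend F) :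
    m (h ⊗ₜ[K] φ.coendOne) = h := by
  suffices m ∘ₗ (TensorProduct.mk K _ _).flip φ.coendOne = LinearMap.id from
    LinearMap.congr_fun this h
  refine LinearMap.ext_on (generates_coendCoact F) ?_
  rintro _ ⟨X, x, ψ, rfl⟩
  simp only [LinearMap.comp_apply, LinearMap.flip_apply, TensorProduct.mk_apply, LinearMap.id_apply]
  rw [coendOne, ← contract_coactTensor, mul_contract hm, hφ.tensorEquiv_one_right,
    ← LinearMap.comp_apply (coendCoact F _), ← lTensor_map_coendCoact, LinearMap.comp_apply,
    contract_lTensor]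
  congr 2
  refine LinearMap.ext fun y => ?_
  simp [← hφ.tensorEquiv_one_right]

section Coalgebra

variable [Coalgebra K (Coend F)]

theorem counit_coendOne (hA : ∀ X, IsCoaction (coendCoact F X)) :
    Coalgebra.counit (R := K) φ.coendOne = 1 := by
  rw [coendOne, (hA _).counit_contract]; simp

theorem comul_coendOne (hA : ∀ X, IsCoaction (coendCoact F X)) :
    Coalgebra.comul (R := K) φ.coendOne = φ.coendOne ⊗ₜ[K] φ.coendOne := by
  rw [coendOne, (hA _).comul_contract, coact_unit]; simp [coact_unit]

/-- The multiplication makes each `φ` an isomorphism between a tensor product coaction and a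
coaction, and the former generate `H ⊗ H`. -/
theorem comul_comp_mul (hA : ∀ X, IsCoaction (coendCoact F X))
    (hm : ∀ X Y, Intertwines m (φ.tensorEquiv X Y).toLinearMap
      (coactTensor (coendCoact F X) (coendCoact F Y)) (coendCoact F (X ⊗ Y))) :
    Coalgebra.comul (R := K) ∘ₗ m = TensorProduct.map m m ∘ₗ Coalgebra.comul (R := K) :=
  ((generates_coendCoact F).tensor (generates_coendCoact F)).comul_comp
    (fun i => (hA i.1).tensor (hA i.2)) (fun i => hA (i.1 ⊗ i.2))
    (fun i => φ.tensorEquiv i.1 i.2) fun i => hm i.1 i.2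

theorem counit_comp_mul (hA : ∀ X, IsCoaction (coendCoact F X))
    (hm : ∀ X Y, Intertwines m (φ.tensorEquiv X Y).toLinearMap
      (coactTensor (coendCoact F X) (coendCoact F Y)) (coendCoact F (X ⊗ Y))) :
    Coalgebra.counit (R := K) ∘ₗ m = Coalgebra.counit (R := K) :=
  ((generates_coendCoact F).tensor (generates_coendCoact F)).counit_comp
    (fun i => (hA i.1).tensor (hA i.2)) (fun i => hA (i.1 ⊗ i.2))
    (fun i => φ.tensorEquiv i.1 i.2) fun i => hm i.1 i.2

theorem reassoc_coendOne (hφ : φ.IsNeutral) (hA : ∀ X, IsCoaction (coendCoact F X))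
    (hω : ∀ X Y Z, hat (coactTensor (coendCoact F X)
      (coactTensor (coendCoact F Y) (coendCoact F Z))) ω = (φ.reassocEquiv X Y Z).toLinearMap)
    (h k : Coend F) :
    ω (h ⊗ₜ[K] (φ.coendOne ⊗ₜ[K] k)) =
      Coalgebra.counit (R := K) h * Coalgebra.counit (R := K) k := by
  suffices ω ∘ₗ TensorProduct.map LinearMap.id (TensorProduct.mk K _ _ φ.coendOne) =
      (TensorProduct.lid K K).toLinearMap ∘ₗ
        TensorProduct.map (Coalgebra.counit (R := K)) (Coalgebra.counit (R := K)) by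
    simpa using LinearMap.congr_fun this (h ⊗ₜ[K] k)
  refine TensorProduct.ext ?_
  refine LinearMap.ext_on (generates_coendCoact F) ?_
  rintro _ ⟨X, x, ψ, rfl⟩
  refine LinearMap.ext_on (generates_coendCoact F) ?_
  rintro _ ⟨Z, z, ζ, rfl⟩
  simp only [LinearMap.comp_apply, TensorProduct.mk_apply,
    TensorProduct.map_tmul, LinearMap.id_apply, LinearEquiv.coe_coe, TensorProduct.lid_tmul,
    (hA _).counit_contract, LinearMap.compr₂ₛₗ_apply]
  rw [coendOne, ← contract_coactTensor, ← contract_coactTensor, ← dual_hat, hω,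
    LinearEquiv.coe_coe, hφ.reassocEquiv_one]
  simp

/-- The two iterated products correspond to `δ` on the two bracketings of `X`, `Y`, `Z`, and `ω`
acts as the colinear map `F (a⁻¹)` between them. -/
theorem convRight_mul_reassoc (hA : ∀ X, IsCoaction (coendCoact F X))
    (hm : ∀ X Y, Intertwines m (φ.tensorEquiv X Y).toLinearMap
      (coactTensor (coendCoact F X) (coendCoact F Y)) (coendCoact F (X ⊗ Y)))
    (hω : ∀ X Y Z, hat (coactTensor (coendCoact F X)
      (coactTensor (coendCoact F Y) (coendCoact F Z))) ω = (φ.reassocEquiv X Y Z).toLinearMap) :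
    convRight (m ∘ₗ m.lTensor (Coend F)) ω =
      convLeft ω (m ∘ₗ m.rTensor (Coend F) ∘ₗ
        (TensorProduct.assoc K _ _ _).symm.toLinearMap) := by
  refine (generates_coactTensor₃ F).hom_ext fun i => ?_
  have hi := (hA i.1).tensor ((hA i.2.1).tensor (hA i.2.2))
  rw [hi.rTensor_convRight, hi.rTensor_convLeft]
  refine (intertwines_rightEquiv hm i.1 i.2.1 i.2.2).lTensor_comp_rTensor
    (intertwines_leftEquiv hm i.1 i.2.1 i.2.2) (intertwines_map (α_ i.1 i.2.1 i.2.2).inv) ?_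
  rw [hω]
  exact φ.leftEquiv_comp_reassocEquiv ..

/-- Both sides act on `F X ⊗ F Y ⊗ F Z ⊗ F W` as the two paths of the transported pentagon. -/
theorem reassoc_cocycle (hA : ∀ X, IsCoaction (coendCoact F X))
    (hm : ∀ X Y, Intertwines m (φ.tensorEquiv X Y).toLinearMap
      (coactTensor (coendCoact F X) (coendCoact F Y)) (coendCoact F (X ⊗ Y)))
    (hω : ∀ X Y Z, hat (coactTensor (coendCoact F X)
      (coactTensor (coendCoact F Y) (coendCoact F Z))) ω = (φ.reassocEquiv X Y Z).toLinearMap) :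
    convLeft (ω ∘ₗ (m.lTensor (Coend F)).lTensor (Coend F))
      (ω ∘ₗ m.rTensor (Coend F ⊗[K] Coend F) ∘ₗ
        (TensorProduct.assoc K (Coend F) (Coend F) (Coend F ⊗[K] Coend F)).symm.toLinearMap) =
    convLeft ((TensorProduct.lid K K).toLinearMap ∘ₗ TensorProduct.map Coalgebra.counit ω)
      (convLeft
        (ω ∘ₗ
          (m.rTensor (Coend F) ∘ₗ
            (TensorProduct.assoc K (Coend F) (Coend F) (Coend F)).symm.toLinearMap).lTensor
              (Coend F))
        ((TensorProduct.lid K K).toLinearMap ∘ₗ TensorProduct.map ω Coalgebra.counit ∘ₗ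
          (TensorProduct.assoc K (Coend F) (Coend F ⊗[K] Coend F) (Coend F)).symm.toLinearMap ∘ₗ
            (TensorProduct.assoc K (Coend F) (Coend F) (Coend F)).symm.toLinearMap.lTensor
              (Coend F))) := by
  refine (generates_coactTensor₄ F).form_ext fun ⟨X, Y, Z, W⟩ => ?_
  obtain ⟨h₁, h₂, h₃, h₄, H₁, H₂, H₃, H₄, hl, hr⟩ := exists_hat_cocycle (hA X) (hA Y) (hA Z) (hA W)
    (hm X Y) (hm Y Z) (hm Z W) ω
  rw [hω] at H₁ H₂ H₃ H₄ hr
  exact hl.trans ((φ.reassocEquiv_pentagon X Y Z W H₁ H₂ H₃ H₄).trans hr.symm)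

end Coalgebra

theorem exists_isCoendomorphism (hφ : φ.IsNeutral) :
    ∃ B : CoquasiBialgebra K (Coend F), IsCoendomorphism φ B := by
  obtain ⟨A, hA⟩ := exists_coalgebra_coend F
  obtain ⟨m, hm⟩ := φ.exists_mul
  obtain ⟨ω, hω⟩ := exists_form_eq F (fun X Y Z => (φ.reassocEquiv X Y Z).toLinearMap)
    φ.reassocEquiv_naturality
  -- The convolution inverse of `ω` is the form that acts by the inverse automorphisms, which are
  -- again natural.
  obtain ⟨ω', hω'⟩ := exists_form_eq F (fun X Y Z => (φ.reassocEquiv X Y Z).symm.toLinearMap)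
    fun {X X' Y Y' Z Z'} f g h => by
      refine LinearMap.ext fun t => ?_
      apply (φ.reassocEquiv X' Y' Z').injective
      refine (LinearMap.congr_fun (φ.reassocEquiv_naturality f g h) _).symm.trans ?_
      simp
  let B : CoquasiBialgebra K (Coend F) :=
    { A with
      mul := m
      one := φ.coendOne
      reassoc := ω
      comul_mul := comul_comp_mul hA hm
      counit_mul := counit_comp_mul hA hm
      comul_one := comul_coendOne hA
      counit_one := counit_coendOne hA
      one_mul := mul_coendOne_left hφ hm
      mul_one := mul_coendOne_right hφ hm
      reassoc_invertible := ⟨ω', convLeft_eq_counit hA fun X Y Z => by rw [hω, hω']; simp,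
        convLeft_eq_counit hA fun X Y Z => by rw [hω, hω']; simp⟩
      reassoc_one := reassoc_coendOne hφ hA hω
      quasi_assoc := convRight_mul_reassoc hA hm hω
      cocycle := reassoc_cocycle hA hm hω }
  refine ⟨B, fun X => (hA X).coassoc, fun X => (hA X).counit, fun X Y => ?_, φ.coendOne_tmul,
    fun X Y Z => ?_⟩
  · refine Eq.trans ?_ (hm X Y)
    rw [theta₂, ← LinearMap.comp_assoc, LinearMap.lTensor_comp_rTensor]
    rfl
  · refine Eq.trans ?_ (φ.leftEquiv_comp_reassocEquiv X Y Z)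
    rw [← hω]
    rfl

end QuasiMonoidal

/-! ### Uniqueness of the coendomorphism structure -/

namespace IsCoendomorphism

variable {φ : QuasiMonoidal F}

theorem isCoaction {B : CoquasiBialgebra K (Coend F)} (hB : IsCoendomorphism φ B) (X : C) :
    IsCoaction (coendCoact F X) :=
  ⟨hB.comul X, hB.counit X⟩

theorem intertwines_mul {B : CoquasiBialgebra K (Coend F)} (hB : IsCoendomorphism φ B) (X Y : C) :
    Intertwines B.mul (φ.tensorEquiv X Y).toLinearMap
      (coactTensor (coendCoact F X) (coendCoact F Y)) (coendCoact F (X ⊗ Y)) := by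
  refine Eq.trans ?_ (hB.mul X Y)
  rw [theta₂, ← LinearMap.comp_assoc, LinearMap.lTensor_comp_rTensor]

theorem one_eq {B : CoquasiBialgebra K (Coend F)} (hB : IsCoendomorphism φ B) :
    B.one = φ.coendOne := by
  have := congrArg (contract φ.unitEquiv.symm.toLinearMap)
    ((hB.one 1).trans (φ.coact_unit 1))
  simpa using this

theorem hat_reassoc {B : CoquasiBialgebra K (Coend F)} (hB : IsCoendomorphism φ B) (X Y Z : C) :
    hat (coactTensor (coendCoact F X) (coactTensor (coendCoact F Y) (coendCoact F Z)))
      B.reassoc = (φ.reassocEquiv X Y Z).toLinearMap := by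
  refine LinearMap.ext fun t => (φ.leftEquiv X Y Z).injective ?_
  refine (LinearMap.congr_fun (hB.reassoc X Y Z) t).trans ?_
  exact (φ.leftEquiv_reassocEquiv X Y Z t).symm

/-- Each defining relation prescribes the action of one structure map on a generating family; for
the unit, `φ₀` is cancelled. -/
theorem unique {B B' : CoquasiBialgebra K (Coend F)} (hB : IsCoendomorphism φ B)
    (hB' : IsCoendomorphism φ B') : B = B' := by
  refine CoquasiBialgebra.ext ?_ ?_ ?_ (hB.one_eq.trans hB'.one_eq.symm) ?_
  · exact (generates_coendCoact F).hom_ext fun X => (hB.comul X).trans (hB'.comul X).symm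
  · exact (generates_coendCoact F).form_ext fun X => (hB.counit X).trans (hB'.counit X).symm
  · refine ((generates_coendCoact F).tensor (generates_coendCoact F)).hom_ext fun ⟨X, Y⟩ => ?_
    refine LinearMap.ext fun t => ?_
    apply (LinearEquiv.lTensor (Coend F) (φ.tensorEquiv X Y)).injective
    exact LinearMap.congr_fun ((hB.mul X Y).trans (hB'.mul X Y).symm) t
  · exact (generates_coactTensor₃ F).form_ext fun ⟨X, Y, Z⟩ =>
      (hB.hat_reassoc X Y Z).trans (hB'.hat_reassoc X Y Z).symm

end IsCoendomorphism

end Reconstruction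

/-! ### Duals and the preantipode -/

section Comodule

variable {K : Type*} [CommRing K] {A : Type*} [AddCommGroup A] [Module K A]
  {M : Type*} [AddCommGroup M] [Module K M] {N : Type*} [AddCommGroup N] [Module K N]

theorem contract_sum {ι : Type*} (s : Finset ι) (μ : ι → Module.Dual K M) (t : A ⊗[K] M) :
    contract (∑ i ∈ s, μ i) t = ∑ i ∈ s, contract (μ i) t := by
  induction t with
  | zero => simp
  | add _ _ h₁ h₂ => simp only [map_add, Finset.sum_add_distrib, h₁, h₂]
  | tmul a m => simp [Finset.sum_smul]

theorem dualTmul_eq_contract (μ : Module.Dual K M) (ν : Module.Dual K N) (t : M ⊗[K] N) :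
    dualTmul μ ν t = μ (contract ν t) := by
  induction t with
  | zero => simp
  | add _ _ h₁ h₂ => simp only [map_add, h₁, h₂]
  | tmul => simp [mul_comm]

end Comodule

section Reconstruction

variable {K : Type w} [CommRing K] {C : Type u} [Category.{v} C] [MonoidalCategory C]
  {F : C ⥤ ModuleCat.{w} K} [LeftRigidCategory C]

namespace QuasiMonoidal

variable (φ : QuasiMonoidal F)

/-- The linear form `y ↦ ev (x ⊗ y)` on `F X^⋆`. -/
noncomputable def evalForm {X : C} (x : F.obj X) : Module.Dual K (F.obj (ᘁX : C)) :=
  φ.evalMap X ∘ₗ TensorProduct.mk K _ _ x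

@[simp] theorem evalForm_apply {X : C} (x : F.obj X) (y : F.obj (ᘁX : C)) :
    φ.evalForm x y = φ.evalMap X (x ⊗ₜ[K] y) := rfl

theorem unitEquiv_evalMap (X : C) (t : F.obj X ⊗[K] F.obj (ᘁX : C)) :
    φ.unitEquiv (φ.evalMap X t) = (F.map (ε_ (ᘁX : C) X)).hom (φ.tensorEquiv X (ᘁX : C) t) := by
  simp [evalMap]

theorem tensorEquiv_dualBasisMap (X : C) (k : K) :
    φ.tensorEquiv (ᘁX : C) X (φ.dualBasisMap X k) =
      (F.map (η_ (ᘁX : C) X)).hom (φ.unitEquiv k) := by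
  simp [dualBasisMap]

/-- Dinaturality of `ev`. Together with the dinaturality of `db` below, it makes `∇(δ)` natural. -/
theorem evalForm_map {X Y : C} (f : X ⟶ Y) (x : F.obj X) :
    φ.evalForm ((F.map f).hom x) = φ.evalForm x ∘ₗ (F.map (ᘁf)).hom := by
  refine LinearMap.ext fun y => φ.unitEquiv.injective ?_
  simp only [evalForm_apply, LinearMap.comp_apply, unitEquiv_evalMap, tensorEquiv_map_left,
    tensorEquiv_map_right]
  simp only [← LinearMap.comp_apply, ← ModuleCat.hom_comp, ← F.map_comp,
    leftAdjointMate_comp_evaluation]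

theorem map_dualBasisMap {X Y : C} (f : X ⟶ Y) (k : K) :
    (F.map f).hom.lTensor (F.obj (ᘁX : C)) (φ.dualBasisMap X k) =
      (F.map (ᘁf)).hom.rTensor (F.obj Y) (φ.dualBasisMap Y k) := by
  apply (φ.tensorEquiv (ᘁX : C) Y).injective
  have h₁ (t) : φ.tensorEquiv (ᘁX : C) Y ((F.map f).hom.lTensor (F.obj (ᘁX : C)) t) =
      (F.map ((ᘁX : C) ◁ f)).hom (φ.tensorEquiv (ᘁX : C) X t) := by
    induction t with
    | zero => simp
    | add _ _ h₁ h₂ => simp only [map_add, h₁, h₂]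
    | tmul x y => exact φ.tensorEquiv_map_right ..
  have h₂ (t) : φ.tensorEquiv (ᘁX : C) Y ((F.map (ᘁf)).hom.rTensor (F.obj Y) t) =
      (F.map ((ᘁf) ▷ Y)).hom (φ.tensorEquiv (ᘁY : C) Y t) := by
    induction t with
    | zero => simp
    | add _ _ h₁ h₂ => simp only [map_add, h₁, h₂]
    | tmul x y => exact φ.tensorEquiv_map_left ..
  rw [h₁, h₂, tensorEquiv_dualBasisMap, tensorEquiv_dualBasisMap]
  simp only [← LinearMap.comp_apply, ← ModuleCat.hom_comp, ← F.map_comp,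
    coevaluation_comp_leftAdjointMate]

theorem contract_comp_map_dualBasisMap {X Y : C} (f : X ⟶ Y) (ψ : Module.Dual K (F.obj Y)) (k : K) :
    contract (ψ ∘ₗ (F.map f).hom) (φ.dualBasisMap X k) =
      (F.map (ᘁf)).hom (contract ψ (φ.dualBasisMap Y k)) := by
  rw [← contract_lTensor, map_dualBasisMap, contract_rTensor]

theorem contract_nabla {V : Type*} [AddCommGroup V] [Module K V]
    (ξ : ∀ X : C, F.obj X →ₗ[K] V ⊗[K] F.obj X) (X : C) (x : F.obj X)
    (ψ : Module.Dual K (F.obj X)) :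
    contract ψ (φ.nabla ξ X x) =
      contract (φ.evalForm x) (ξ (ᘁX : C) (contract ψ (φ.dualBasisMap X 1))) := by
  simp only [nabla, LinearMap.comp_apply, LinearEquiv.coe_coe, TensorProduct.rid_symm_apply,
    LinearMap.lTensor_tmul]
  generalize φ.dualBasisMap X 1 = d
  induction d with
  | zero => simp
  | add _ _ h₁ h₂ => simp only [map_add, TensorProduct.tmul_add, h₁, h₂]
  | tmul y z =>
    simp only [LinearMap.rTensor_tmul, contract_tmul, map_smul]
    generalize ξ (ᘁX : C) y = t
    induction t with
    | zero => simp
    | add _ _ h₁ h₂ =>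
      simp only [map_add, TensorProduct.tmul_add, TensorProduct.add_tmul, h₁, h₂, smul_add]
    | tmul v y => simp [smul_smul, mul_comm]

/-- The zigzag identity for `ev` and `db`, twisted by the associativity constraint. -/
theorem IsNeutral.evalMap_reassocEquiv_dualBasisMap {φ : QuasiMonoidal F} (hφ : φ.IsNeutral)
    (X : C) (x : F.obj X) (ψ : Module.Dual K (F.obj X)) :
    dualTmul (φ.evalMap X) ψ ((TensorProduct.assoc K _ _ _).symm
      (φ.reassocEquiv X (ᘁX : C) X (x ⊗ₜ[K] φ.dualBasisMap X 1))) = ψ x := by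
  have h₁ (t : F.obj X ⊗[K] (F.obj (ᘁX : C) ⊗[K] F.obj X)) :
      dualTmul (φ.evalMap X) ψ ((TensorProduct.assoc K _ _ _).symm t) =
        ψ ((F.map (λ_ X).hom).hom ((F.map (ε_ (ᘁX : C) X ▷ X)).hom
          (φ.leftEquiv X (ᘁX : C) X t))) := by
    induction t with
    | zero => simp
    | add _ _ h₁ h₂ => simp only [map_add, h₁, h₂]
    | tmul x t =>
      induction t with
      | zero => simp
      | add _ _ h₁ h₂ => simp only [map_add, TensorProduct.tmul_add, h₁, h₂]
      | tmul y z =>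
        rw [leftEquiv_tmul, ← tensorEquiv_map_left, ← unitEquiv_evalMap, hφ.map_leftUnitor]
        simp
  rw [h₁, leftEquiv_reassocEquiv, rightEquiv_tmul, tensorEquiv_dualBasisMap,
    tensorEquiv_map_right, hφ.tensorEquiv_one_right]
  simp only [← LinearMap.comp_apply, ← ModuleCat.hom_comp, ← F.map_comp, Category.assoc]
  have : (ρ_ X).inv ≫ X ◁ η_ (ᘁX : C) X ≫ (α_ X (ᘁX : C) X).inv ≫ ε_ (ᘁX : C) X ▷ X ≫
      (λ_ X).hom = 𝟙 X := by
    rw [ExactPairing.coevaluation_evaluation_assoc]; simp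
  rw [LinearMap.comp_apply, this]
  simp

variable [∀ X, Module.Finite K (F.obj X)] [∀ X, Module.Projective K (F.obj X)]

theorem exists_theta_eq_nabla : ∃ S : Coend F →ₗ[K] Coend F,
    ∀ X : C, theta F S X = φ.nabla (coendCoact F) X := by
  refine exists_theta_eq F _ fun {X Y} f => LinearMap.ext fun x => contract_ext fun ψ => ?_
  simp only [LinearMap.comp_apply, contract_lTensor, contract_nabla, evalForm_map,
    contract_comp_map_dualBasisMap]
  rw [← LinearMap.comp_apply (coendCoact F _), ← lTensor_map_coendCoact, LinearMap.comp_apply,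
    contract_lTensor]

/-- On coefficients `S` exchanges the roles of vector and form: `ev` turns `x` into a form on `F
X^⋆`, and `db` turns `ψ` into a vector. -/
theorem antipode_contract {S : Coend F →ₗ[K] Coend F}
    (hS : ∀ X : C, theta F S X = φ.nabla (coendCoact F) X) (X : C) (x : F.obj X)
    (ψ : Module.Dual K (F.obj X)) :
    S (contract ψ (coendCoact F X x)) =
      contract (φ.evalForm x) (coendCoact F (ᘁX : C) (contract ψ (φ.dualBasisMap X 1))) := by
  rw [← contract_rTensor, ← contract_nabla, ← hS]; rfl

variable {φ} {m : Coend F ⊗[K] Coend F →ₗ[K] Coend F}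

/-- Since `F (db)` is colinear and starts at `F 𝟙`, the dual basis element is coinvariant. -/
theorem mul_contract_dualBasisMap (hm : ∀ X Y, Intertwines m (φ.tensorEquiv X Y).toLinearMap
      (coactTensor (coendCoact F X) (coendCoact F Y)) (coendCoact F (X ⊗ Y))) (X : C)
    (μ : Module.Dual K (F.obj (ᘁX : C) ⊗[K] F.obj X)) :
    m (contract μ (coactTensor (coendCoact F (ᘁX : C)) (coendCoact F X) (φ.dualBasisMap X 1))) =
      μ (φ.dualBasisMap X 1) • φ.coendOne := by
  rw [mul_contract hm, tensorEquiv_dualBasisMap, ← LinearMap.comp_apply (coendCoact F _),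
    ← lTensor_map_coendCoact, LinearMap.comp_apply, contract_lTensor, coact_unit, contract_tmul,
    LinearMap.comp_apply, ← tensorEquiv_dualBasisMap]
  simp

/-- Since `F (ev)` is colinear with values in `F 𝟙`, contracting with `ev` leaves only multiples of
the unit. -/
theorem mul_contract_evalMap (hm : ∀ X Y, Intertwines m (φ.tensorEquiv X Y).toLinearMap
      (coactTensor (coendCoact F X) (coendCoact F Y)) (coendCoact F (X ⊗ Y))) (X : C)
    (t : F.obj X ⊗[K] F.obj (ᘁX : C)) :
    m (contract (φ.evalMap X) (coactTensor (coendCoact F X) (coendCoact F (ᘁX : C)) t)) =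
      φ.evalMap X t • φ.coendOne := by
  have : φ.evalMap X ∘ₗ (φ.tensorEquiv X (ᘁX : C)).symm.toLinearMap =
      φ.unitEquiv.symm.toLinearMap ∘ₗ (F.map (ε_ (ᘁX : C) X)).hom := by
    refine LinearMap.ext fun y => ?_
    simp [evalMap]
  rw [mul_contract hm, this, ← contract_lTensor, ← LinearMap.comp_apply (LinearMap.lTensor _ _),
    lTensor_map_coendCoact, LinearMap.comp_apply, ← unitEquiv_evalMap, coact_unit, contract_tmul]
  simp

end QuasiMonoidal

variable [∀ X, Module.Finite K (F.obj X)] [∀ X, Module.Projective K (F.obj X)]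

theorem IsCoendomorphism.isPreantipode {φ : QuasiMonoidal F} (hφ : φ.IsNeutral)
    {B : CoquasiBialgebra K (Coend F)} (hB : IsCoendomorphism φ B) {S : Coend F →ₗ[K] Coend F}
    (hS : ∀ X : C, theta F S X = φ.nabla (coendCoact F) X) : IsPreantipode K S := by
  have hm := hB.intertwines_mul
  have hA := hB.isCoaction
  have hS' := φ.antipode_contract hS
  -- Summing over the dual basis inserted by `Δ` reassembles `ev` from its partial evaluations.
  have sum_eval (X : C) {n : ℕ} {e : Fin n → F.obj X} {e' : Fin n → Module.Dual K (F.obj X)}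
      (he : ∀ x, ∑ i, e' i x • e i = x) :
      ∑ i, dualTmul (e' i) (φ.evalForm (e i)) = φ.evalMap X := by
    refine TensorProduct.ext' fun x y => ?_
    conv_rhs => rw [← he x]
    simp [TensorProduct.sum_tmul, ← TensorProduct.smul_tmul']
  refine ⟨fun h => ?_, fun h => ?_, fun h => ?_⟩
  · suffices B.mul.rTensor (Coend F) ∘ₗ
        (TensorProduct.rightComm K (Coend F) (Coend F) (Coend F)).toLinearMap ∘ₗ
          (Coalgebra.comul ∘ₗ S).rTensor (Coend F) ∘ₗ Coalgebra.comul (R := K) =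
        TensorProduct.mk K _ _ B.one ∘ₗ S from LinearMap.congr_fun this h
    refine LinearMap.ext_on (generates_coendCoact F) ?_
    rintro _ ⟨X, x, ψ, rfl⟩
    obtain ⟨n, e, e', he⟩ := exists_dual_basis K (F.obj X)
    obtain ⟨n', f, f', hf⟩ := exists_dual_basis K (F.obj (ᘁX : C))
    simp only [LinearMap.comp_apply, (hA X).comul_contract_eq_sum he, map_sum,
      LinearMap.rTensor_tmul, hS', (hA (ᘁX : C)).comul_contract_eq_sum hf, TensorProduct.sum_tmul,
      LinearEquiv.coe_coe, TensorProduct.rightComm_tmul, TensorProduct.mk_apply]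
    rw [Finset.sum_comm]
    -- The sum over `i` reassembles the dual basis element, whose coinvariance produces the unit;
    -- the sum over `j` then rebuilds `S h`.
    have key (j : Fin n') : ∑ i, B.mul (contract (f' j) (coendCoact F (ᘁX : C)
          (contract (e' i) (φ.dualBasisMap X 1))) ⊗ₜ[K] contract ψ (coendCoact F X (e i))) =
        f' j (contract ψ (φ.dualBasisMap X 1)) • φ.coendOne := by
      simp only [← contract_coactTensor, ← map_sum, sum_contract_tmul he]
      rw [QuasiMonoidal.mul_contract_dualBasisMap hm, dualTmul_eq_contract]
    simp only [← TensorProduct.sum_tmul, key, hB.one_eq, TensorProduct.smul_tmul, ← map_smul,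
      ← TensorProduct.tmul_sum, ← map_sum, hf]
  · suffices B.mul.lTensor (Coend F) ∘ₗ
        (TensorProduct.leftComm K (Coend F) (Coend F) (Coend F)).toLinearMap ∘ₗ
          (Coalgebra.comul ∘ₗ S).lTensor (Coend F) ∘ₗ Coalgebra.comul (R := K) =
        (TensorProduct.mk K _ _).flip B.one ∘ₗ S from LinearMap.congr_fun this h
    refine LinearMap.ext_on (generates_coendCoact F) ?_
    rintro _ ⟨X, x, ψ, rfl⟩
    obtain ⟨n, e, e', he⟩ := exists_dual_basis K (F.obj X)
    obtain ⟨n', f, f', hf⟩ := exists_dual_basis K (F.obj (ᘁX : C))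
    simp only [LinearMap.comp_apply, (hA X).comul_contract_eq_sum he, map_sum,
      LinearMap.lTensor_tmul, hS', (hA (ᘁX : C)).comul_contract_eq_sum hf, TensorProduct.tmul_sum,
      LinearEquiv.coe_coe, TensorProduct.leftComm_tmul, TensorProduct.mk_apply,
      LinearMap.flip_apply]
    -- With the sum over `i` innermost, the forms add up to `ev`, whose colinearity produces the
    -- unit.
    rw [Finset.sum_comm]
    have key (j : Fin n') : ∑ i, B.mul (contract (e' i) (coendCoact F X x) ⊗ₜ[K]
          contract (φ.evalForm (e i)) (coendCoact F (ᘁX : C) (f j))) =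
        φ.evalForm x (f j) • φ.coendOne := by
      simp only [← contract_coactTensor, ← map_sum, ← contract_sum, sum_eval X he]
      rw [QuasiMonoidal.mul_contract_evalMap hm]
      rfl
    simp only [← TensorProduct.tmul_sum, key, hB.one_eq, TensorProduct.tmul_smul,
      TensorProduct.smul_tmul', ← TensorProduct.sum_tmul]
    conv_rhs => rw [← sum_contract_tmul hf (coendCoact F (ᘁX : C) _), map_sum]
    simp only [contract_tmul]
  · suffices B.reassoc ∘ₗ (S.rTensor (Coend F) ∘ₗ Coalgebra.comul).lTensor (Coend F) ∘ₗ
        Coalgebra.comul (R := K) = Coalgebra.counit (R := K) from LinearMap.congr_fun this h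
    refine LinearMap.ext_on (generates_coendCoact F) ?_
    rintro _ ⟨X, x, ψ, rfl⟩
    obtain ⟨n, e, e', he⟩ := exists_dual_basis K (F.obj X)
    simp only [LinearMap.comp_apply, (hA X).comul_contract_eq_sum he, map_sum,
      LinearMap.lTensor_tmul, LinearMap.rTensor_tmul, hS', TensorProduct.tmul_sum,
      (hA X).counit_contract]
    -- The form `ω` is replaced by the transported associator. Summing over `j` rebuilds `db` and
    -- summing over `i` rebuilds `ev`, which leaves the zigzag identity.
    have key (i j : Fin n) : B.reassoc (contract (e' i) (coendCoact F X x) ⊗ₜ[K]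
          (contract (φ.evalForm (e i)) (coendCoact F (ᘁX : C)
            (contract (e' j) (φ.dualBasisMap X 1))) ⊗ₜ[K] contract ψ (coendCoact F X (e j)))) =
        dualTmul (e' i) (dualTmul (φ.evalForm (e i)) ψ) (φ.reassocEquiv X (ᘁX : C) X
          (x ⊗ₜ[K] (contract (e' j) (φ.dualBasisMap X 1) ⊗ₜ[K] e j))) := by
      rw [← contract_coactTensor, ← contract_coactTensor, ← dual_hat, hB.hat_reassoc]
      rfl
    have assoc_form (i : Fin n) (t) : dualTmul (e' i) (dualTmul (φ.evalForm (e i)) ψ) t =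
        dualTmul (dualTmul (e' i) (φ.evalForm (e i))) ψ
          ((TensorProduct.assoc K _ _ _).symm t) := by
      induction t with
      | zero => simp
      | add _ _ h₁ h₂ => simp only [map_add, h₁, h₂]
      | tmul x t =>
        induction t with
        | zero => simp
        | add _ _ h₁ h₂ => simp only [map_add, TensorProduct.tmul_add, h₁, h₂]
        | tmul y z => simp [mul_assoc]
    simp only [key, ← map_sum, ← TensorProduct.tmul_sum, sum_contract_tmul he, assoc_form,
      dualTmul_eq_contract _ ψ]
    rw [← LinearMap.sum_apply, sum_eval X he, ← dualTmul_eq_contract,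
      hφ.evalMap_reassocEquiv_dualBasisMap]

end Reconstruction

theorem mainTheorem1 {K : Type w} [CommRing K] {C : Type u} [Category.{v} C] [MonoidalCategory C]
    [EssentiallySmall.{w} C] [LeftRigidCategory C] (F : C ⥤ ModuleCat.{w} K)
    [∀ X, Module.Finite K (F.obj X)] [∀ X, Module.Projective K (F.obj X)]
    (φ : QuasiMonoidal F) (hφ : φ.IsNeutral) :
    Small.{w} (Coend F) ∧
    ∃ B : CoquasiBialgebra K (Coend F),
      IsCoendomorphism φ B ∧
      (∀ B' : CoquasiBialgebra K (Coend F), IsCoendomorphism φ B' → B' = B) ∧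
      ∃ S : Coend F →ₗ[K] Coend F,
        (∀ T : Coend F →ₗ[K] Coend F,
          (∀ X : C, theta F T X = φ.nabla (coendCoact F) X) ↔ T = S) ∧
        IsPreantipode K S := by
  obtain ⟨B, hB⟩ := QuasiMonoidal.exists_isCoendomorphism hφ
  obtain ⟨S, hS⟩ := φ.exists_theta_eq_nabla
  refine ⟨small_coend, B, hB, fun B' hB' => hB'.unique hB, S, fun T => ⟨fun hT => ?_, ?_⟩,
    hB.isPreantipode hφ hS⟩
  · exact (generates_coendCoact F).hom_ext fun X => (hT X).trans (hS X).symm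
  · rintro rfl
    exact hS
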